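/- **Conventions.** Each of the three games is taken with a single player, without turn limit, and on the infinite hexagonal map $\mathbb Z^2$ (axial coordinates, six neighbours per tile); all tiles are flat and traversable, and a unit moves one hex per turn. A *game state* is a finite record of the position (listed below). Each turn the player gives orders; orders that the rules do not permit cannot be given. * **Civ:BE.** A state records which tiles are desert, which are owned by the player's Cities, which are worked by Citizens, whether the player has the Terraforming technology and the Ecoscaping civic, which improvement (Road, Pillaged Road, Terrascape) each tile has (finitely many tiles have one), and two Workers and a Rover. A Worker may move, build a Road on any unimproved tile, build a Terrascape on an owned unimproved desert tile (with Terraforming), remove an improvement (one turn), or repair a Pillaged Road (one turn); the Rover may move or pillage a Road outside the player's borders. Building a Road or a Terrascape takes fixed numbers of turns. The Culture yield is $C_t=C_*+(y+e)\cdot\#\{\text{worked Terrascapes}\}$, with constants $C_*,y\in\mathbb N$ and $e=1$ if the player has Ecoscaping, $e=0$ otherwise. *Observed:* $C_t-C_*$ and the improvement under the tape Worker. * **Civ:V.** A state records the owned tiles, whether the player has Engineering, the improvements (Road, Railroad; finitely many), and two Workers. A Worker may move, build a Road or (with Engineering) a Railroad on any unimproved tile, each in a fixed number of turns, or remove one in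 one turn. *Observed:* the number of Railroads on owned tiles and the improvement under the tape Worker. * **Civ:VI.** The map is a strip of grassland (Food $2$) surrounded by floodplains (Food $3$). A state records finitely many Cities, the tiles with a Monastery and those with a Farm, a Worker (which only marks a position), and possibly a Settler. A City has a tile, a set of owned tiles, a population (one Citizen works the City itself, the others work distinct other owned tiles), stored Food, and possibly a growth cap set by the player. The player may reassign Citizens within a City, cap a City's growth, let a City with at least two Citizens train a Settler (cost $30\cdot\#\text{Cities}+50$ at a fixed positive Production per turn; the City loses one Citizen), and found a City with the Settler on an unowned tile at distance at least $4$ from all other Cities; the new City owns its tile and the adjacent unowned ones and starts with two Citizens. A City produces $2$ Food plus that of its own terrain and of its worked tiles (a Farm adds $1$); each Citizen consumes $2$. A City below its cap stores the surplus and gains a Citizen when it has stored a given amount depending on its population. New Citizens work the free tile of highest combined yield. The Faith yield is $F_t=F_*+2\cdot\#\{\text{worked Monasteries}\}$. *Observed:* $F_t-F_*$, whether the Worker's tile is being worked, the population of the City owning that tile and the Worker's position relative to that City, and whether there is a Settler. A state is *valid* if it is consistent with these rules (with no construction under way in Civ:BE and Civ:V). A *command table* is a finite table that assigns to observations finite sequences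 of orders for consecutive turns; an observation without entry means HALT. *Following* a table from a state means: observe, carry out the listed orders, observe again, and so on; this *halts* if every order on the way is permitted and an observation that means HALT is reached after finitely many turns. **Corollary (undecidability).** For each of Civ:BE, Civ:V and Civ:VI, and for all values of the constants of the game, there is a single command table $T$ such that 1. following $T$, the game simulates a universal Turing machine: there is a computable map that sends a program $c$ (of a partial recursive function) and an input $n\in\mathbb N$ to a valid game state $s_{c,n}$ such that following $T$ from $s_{c,n}$ halts if and only if the computation of $c$ on $n$ halts; and 2. the game is undecidable: no algorithm decides, given a valid game state $s$, whether following $T$ from $s$ halts. -/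

import Mathlib

/-! ### Turn-based single-player games and play according to a command table -/

/-- A single-player turn-based game. `turn s o` is the state after one turn in which the player
gives the orders `o`, or `none` if the rules do not permit these orders in state `s`.
There is no turn limit. `observe` is what the player reads off the screen before issuing a
command. `Valid` singles out the states that are consistent with the rules. -/
structure CivGame (State Order Obs : Type) where
  turn : State → Order → Option State
  observe : State → Obs
  Valid : State → Prop

/-- A finite command table: what is observed determines a finite list of orders, to be carried
out on consecutive turns. An observation without an entry means `HALT`. -/
abbrev CommandTable (Obs Order : Type) := List (Obs × List Order)

namespace CivGame

variable {State Order Obs : Type} [DecidableEq Obs]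

/-- One command of the table, carried out in full by legal turns of the game, leads from `s`
to `s'`. -/
def Round (G : CivGame State Order Obs) (T : CommandTable Obs Order) (s s' : State) : Prop :=
  ∃ os : List Order, T.lookup (G.observe s) = some os ∧ os.foldlM G.turn s = some s'

/-- Starting in state `s` and following the table `T`, the player reaches, after finitely many
turns, a state in which the table says `HALT`. -/
def Halts (G : CivGame State Order Obs) (T : CommandTable Obs Order) (s : State) : Prop :=
  ∃ s' : State, Relation.ReflTransGen (G.Round T) s s' ∧ T.lookup (G.observe s') = none

/-- Under the fixed table `T` the game simulates every machine: a program `c` and an input `n` can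
be effectively turned into a valid game state from which the play halts if and only if the
computation of `c` on `n` does. -/
def SimulatesUniversal [Primcodable State] (G : CivGame State Order Obs)
    (T : CommandTable Obs Order) : Prop :=
  ∃ enc : Nat.Partrec.Code → ℕ → State, Computable₂ enc ∧
    ∀ c n, G.Valid (enc c n) ∧ (G.Halts T (enc c n) ↔ (c.eval n).Dom)

/-- No algorithm decides, given a valid game state, whether the play according to `T` halts. -/
def UndecidableUnder [Primcodable State] (G : CivGame State Order Obs)
    (T : CommandTable Obs Order) : Prop :=
  ¬ ∃ f : State → Bool, Computable f ∧ ∀ s, G.Valid s → (f s = true ↔ G.Halts T s)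

end CivGame

/-! ### The infinite hexagonal map -/

/-- The tiles of the map, in axial coordinates. The map is infinite in every direction. -/
abbrev Hex := ℤ × ℤ

/-- The six directions on the hexagonal map. -/
inductive HexDir
  | east | west | northEast | northWest | southEast | southWest
  deriving DecidableEq

/-- The step to the adjacent tile in a direction. -/
def HexDir.vec : HexDir → Hex
  | east => (1, 0)
  | west => (-1, 0)
  | northEast => (1, -1)
  | northWest => (0, -1)
  | southEast => (0, 1)
  | southWest => (-1, 1)

namespace Hex

/-- The number of steps between two tiles. -/
def dist (a b : Hex) : ℕ :=
  max (max (a.1 - b.1).natAbs (a.2 - b.2).natAbs) ((a.1 - b.1) + (a.2 - b.2)).natAbs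

/-- The six tiles adjacent to a tile. -/
def neighbors (h : Hex) : List Hex :=
  [HexDir.east, .west, .northEast, .northWest, .southEast, .southWest].map fun d => h + d.vec

end Hex

/-- A Worker: its position, and the construction under way on its tile, if any, with the number
of turns already spent on it. -/
structure Worker (Project : Type) where
  pos : Hex
  job : Option (Project × ℕ)

/-- Workers as tuples. -/
def Worker.equiv (Project : Type) : Worker Project ≃ Hex × Option (Project × ℕ) where
  toFun w := (w.pos, w.job)
  invFun t := ⟨t.1, t.2⟩
  left_inv _ := rfl
  right_inv _ := rfl

instance {Project : Type} [Primcodable Project] : Primcodable (Worker Project) :=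
  Primcodable.ofEquiv _ (Worker.equiv Project)

/-- One more turn of work on project `p`, which costs `cost` turns: the new state of the Worker,
and whether the project is now complete. -/
def Worker.work {Project : Type} [DecidableEq Project] (w : Worker Project) (p : Project)
    (cost : ℕ) : Worker Project × Bool :=
  let spent := match w.job with
    | some (p', k) => if p' = p then k + 1 else 1
    | none => 1
  if cost ≤ spent then (⟨w.pos, none⟩, true) else (⟨w.pos, some (p, spent)⟩, false)

/-- Moving to an adjacent tile, which takes a turn and abandons any construction under way. -/
def Worker.move {Project : Type} (w : Worker Project) (d : HexDir) : Worker Project :=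
  ⟨w.pos + d.vec, none⟩

/-! ### Civ:BE -/

namespace CivBE

/-- Constants of the game: the number of turns it takes to build a Terrascape and a Road, the
Culture yield of a Terrascape without the Ecoscaping civic, and the base Culture per turn. -/
structure Rules where
  terrascapeTurns : ℕ
  roadTurns : ℕ
  terrascapeCulture : ℕ
  baseCulture : ℕ

/-- What can be on a tile. -/
inductive Improvement
  | unimproved | road | pillagedRoad | terrascape
  deriving DecidableEq

/-- What a Worker can build. -/
inductive Project
  | road | terrascape
  deriving DecidableEq

/-- Numbering of the improvements. -/
def Improvement.equiv : Improvement ≃ Fin 4 where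
  toFun
    | .unimproved => 0
    | .road => 1
    | .pillagedRoad => 2
    | .terrascape => 3
  invFun
    | 0 => .unimproved
    | 1 => .road
    | 2 => .pillagedRoad
    | 3 => .terrascape
  left_inv i := by cases i <;> rfl
  right_inv i := by fin_cases i <;> rfl

instance : Primcodable Improvement := Primcodable.ofEquiv _ Improvement.equiv

/-- Numbering of the projects. -/
def Project.equiv : Project ≃ Bool where
  toFun
    | .road => false
    | .terrascape => true
  invFun
    | false => .road
    | true => .terrascape
  left_inv i := by cases i <;> rfl
  right_inv i := by cases i <;> rfl

instance : Primcodable Project := Primcodable.ofEquiv _ Project.equiv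

/-- A state of the game. The tiles in `desert` are flat desert, all others are flat and
traversable; `owned` are the tiles of the player's Cities, `worked` those on which a
Citizen works; `improved` records the improvements (the first entry of a tile counts, a tile without
entry is unimproved); `terraforming` and `ecoscaping` say whether the player has that technology
and that civic. The units are two Workers and a Rover. -/
structure State where
  desert : List Hex
  owned : List Hex
  worked : List Hex
  terraforming : Bool
  ecoscaping : Bool
  improved : List (Hex × Improvement)
  stateWorker : Worker Project
  tapeWorker : Worker Project
  rover : Hex

/-- States as tuples. -/
def State.equiv : State ≃ List Hex × List Hex × List Hex × Bool × Bool ×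
    List (Hex × Improvement) × Worker Project × Worker Project × Hex where
  toFun s := (s.desert, s.owned, s.worked, s.terraforming, s.ecoscaping, s.improved,
    s.stateWorker, s.tapeWorker, s.rover)
  invFun t := ⟨t.1, t.2.1, t.2.2.1, t.2.2.2.1, t.2.2.2.2.1, t.2.2.2.2.2.1, t.2.2.2.2.2.2.1,
    t.2.2.2.2.2.2.2.1, t.2.2.2.2.2.2.2.2⟩
  left_inv _ := rfl
  right_inv _ := rfl

instance : Primcodable State := Primcodable.ofEquiv _ State.equiv

/-- The improvement on a tile. -/
def State.improvementAt (s : State) (h : Hex) : Improvement :=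
  (s.improved.lookup h).getD .unimproved

/-- Change the improvement on a tile. -/
def State.setImprovement (s : State) (h : Hex) (i : Improvement) : State :=
  { s with improved := (h, i) :: s.improved }

/-- The Culture yield per turn: every worked Terrascape counts, and Ecoscaping gives `+1` for each. -/
def State.culture (r : Rules) (s : State) : ℕ :=
  r.baseCulture + (r.terrascapeCulture + if s.ecoscaping then 1 else 0) *
    s.worked.countP fun h => s.improvementAt h = .terrascape

/-- Orders to a Worker for one turn. -/
inductive WorkerOrder
  | wait
  | move (d : HexDir)
  | build (p : Project)
  | remove
  | repair

/-- Orders to the Rover for one turn. -/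
inductive RoverOrder
  | wait
  | move (d : HexDir)
  | pillage

/-- One turn of a Worker. Roads can be built on any unimproved tile; Terrascapes on the player's
unimproved desert tiles if Terraforming is known. Removing an improvement and repairing
a pillaged Road take one turn. -/
def workerTurn (r : Rules) (s : State) (w : Worker Project) :
    WorkerOrder → Option (State × Worker Project)
  | .wait => some (s, w)
  | .move d => some (s, w.move d)
  | .build .road =>
      if s.improvementAt w.pos = .unimproved then
        let x := w.work .road r.roadTurns
        some (if x.2 then s.setImprovement w.pos .road else s, x.1)
      else none
  | .build .terrascape =>
      if s.improvementAt w.pos = .unimproved ∧ w.pos ∈ s.owned ∧ w.pos ∈ s.desert ∧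
          s.terraforming = true then
        let x := w.work .terrascape r.terrascapeTurns
        some (if x.2 then s.setImprovement w.pos .terrascape else s, x.1)
      else none
  | .remove =>
      if s.improvementAt w.pos ≠ .unimproved then
        some (s.setImprovement w.pos .unimproved, ⟨w.pos, none⟩)
      else none
  | .repair =>
      if s.improvementAt w.pos = .pillagedRoad then
        some (s.setImprovement w.pos .road, ⟨w.pos, none⟩)
      else none

/-- One turn of the Rover. Roads can be pillaged outside the player's own borders. -/
def roverTurn (s : State) : RoverOrder → Option State
  | .wait => some s
  | .move d => some { s with rover := s.rover + d.vec }
  | .pillage =>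
      if s.improvementAt s.rover = .road ∧ s.rover ∉ s.owned then
        some (s.setImprovement s.rover .pillagedRoad)
      else none

/-- The orders for one turn. -/
structure Order where
  stateWorker : WorkerOrder
  tapeWorker : WorkerOrder
  rover : RoverOrder

/-- One turn of the game. -/
def turn (r : Rules) (s : State) (o : Order) : Option State := do
  let (s, w) ← workerTurn r s s.stateWorker o.stateWorker
  let s := { s with stateWorker := w }
  let (s, w) ← workerTurn r s s.tapeWorker o.tapeWorker
  let s := { s with tapeWorker := w }
  roverTurn s o.rover

/-- What the command table refers to: the change of the Culture yield relative to the base yield,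
and the improvement on the tile of the tape Worker. -/
def observe (r : Rules) (s : State) : ℕ × Improvement :=
  (s.culture r - r.baseCulture, s.improvementAt s.tapeWorker.pos)

/-- Consistency of a game state: Citizens work only tiles of the player's Cities, at most one per
tile, Terrascapes stand only on the player's desert tiles, pillaged Roads only outside the
player's borders, and no construction is under way. -/
structure Valid (s : State) : Prop where
  worked_nodup : s.worked.Nodup
  worked_owned : ∀ h ∈ s.worked, h ∈ s.owned
  terrascape : ∀ h, s.improvementAt h = .terrascape → h ∈ s.owned ∧ h ∈ s.desert
  pillaged : ∀ h, s.improvementAt h = .pillagedRoad → h ∉ s.owned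
  stateWorker_idle : s.stateWorker.job = none
  tapeWorker_idle : s.tapeWorker.job = none

/-- Single-player Civ:BE on the infinite map without turn limit. -/
def game (r : Rules) : CivGame State Order (ℕ × Improvement) where
  turn := turn r
  observe := observe r
  Valid := Valid

end CivBE

/-! ### Civ:V -/

namespace CivV

/-- Constants of the game: the number of turns it takes to build a Road and a Railroad. -/
structure Rules where
  roadTurns : ℕ
  railroadTurns : ℕ

/-- What can be on a tile. -/
inductive Improvement
  | unimproved | road | railroad
  deriving DecidableEq

/-- What a Worker can build. -/
inductive Project
  | road | railroad
  deriving DecidableEq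

/-- Numbering of the improvements. -/
def Improvement.equiv : Improvement ≃ Fin 3 where
  toFun
    | .unimproved => 0
    | .road => 1
    | .railroad => 2
  invFun
    | 0 => .unimproved
    | 1 => .road
    | 2 => .railroad
  left_inv i := by cases i <;> rfl
  right_inv i := by fin_cases i <;> rfl

instance : Primcodable Improvement := Primcodable.ofEquiv _ Improvement.equiv

/-- Numbering of the projects. -/
def Project.equiv : Project ≃ Bool where
  toFun
    | .road => false
    | .railroad => true
  invFun
    | false => .road
    | true => .railroad
  left_inv i := by cases i <;> rfl
  right_inv i := by cases i <;> rfl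

instance : Primcodable Project := Primcodable.ofEquiv _ Project.equiv

/-- A state of the game. All tiles are flat and traversable; `owned` are the tiles of the player's
Cities; `improved` records the improvements (the first entry of a tile counts, a tile
without entry is unimproved); `engineering` says whether the player has that technology. The units
are two Workers. -/
structure State where
  owned : List Hex
  engineering : Bool
  improved : List (Hex × Improvement)
  stateWorker : Worker Project
  tapeWorker : Worker Project

/-- States as tuples. -/
def State.equiv : State ≃ List Hex × Bool × List (Hex × Improvement) ×
    Worker Project × Worker Project where
  toFun s := (s.owned, s.engineering, s.improved, s.stateWorker, s.tapeWorker)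
  invFun t := ⟨t.1, t.2.1, t.2.2.1, t.2.2.2.1, t.2.2.2.2⟩
  left_inv _ := rfl
  right_inv _ := rfl

instance : Primcodable State := Primcodable.ofEquiv _ State.equiv

/-- The improvement on a tile. -/
def State.improvementAt (s : State) (h : Hex) : Improvement :=
  (s.improved.lookup h).getD .unimproved

/-- Change the improvement on a tile. -/
def State.setImprovement (s : State) (h : Hex) (i : Improvement) : State :=
  { s with improved := (h, i) :: s.improved }

/-- The number of Railroads in the player's territory. -/
def State.railroads (s : State) : ℕ :=
  s.owned.countP fun h => s.improvementAt h = .railroad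

/-- Orders to a Worker for one turn. -/
inductive WorkerOrder
  | wait
  | move (d : HexDir)
  | build (p : Project)
  | remove

/-- One turn of a Worker. Roads and, with Engineering, Railroads can be built on any unimproved
tile (an existing one has to be removed first); removing takes one turn. -/
def workerTurn (r : Rules) (s : State) (w : Worker Project) :
    WorkerOrder → Option (State × Worker Project)
  | .wait => some (s, w)
  | .move d => some (s, w.move d)
  | .build .road =>
      if s.improvementAt w.pos = .unimproved then
        let x := w.work .road r.roadTurns
        some (if x.2 then s.setImprovement w.pos .road else s, x.1)
      else none
  | .build .railroad =>
      if s.improvementAt w.pos = .unimproved ∧ s.engineering = true then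
        let x := w.work .railroad r.railroadTurns
        some (if x.2 then s.setImprovement w.pos .railroad else s, x.1)
      else none
  | .remove =>
      if s.improvementAt w.pos ≠ .unimproved then
        some (s.setImprovement w.pos .unimproved, ⟨w.pos, none⟩)
      else none

/-- The orders for one turn. -/
structure Order where
  stateWorker : WorkerOrder
  tapeWorker : WorkerOrder

/-- One turn of the game. -/
def turn (r : Rules) (s : State) (o : Order) : Option State := do
  let (s, w) ← workerTurn r s s.stateWorker o.stateWorker
  let s := { s with stateWorker := w }
  let (s, w) ← workerTurn r s s.tapeWorker o.tapeWorker
  pure { s with tapeWorker := w }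

/-- What the command table refers to: the number of Railroads in the player's territory, and the
improvement on the tile of the tape Worker. -/
def observe (s : State) : ℕ × Improvement :=
  (s.railroads, s.improvementAt s.tapeWorker.pos)

/-- Consistency of a game state: every owned tile is listed once, and no construction is under
way. -/
structure Valid (s : State) : Prop where
  owned_nodup : s.owned.Nodup
  stateWorker_idle : s.stateWorker.job = none
  tapeWorker_idle : s.tapeWorker.job = none

/-- Single-player Civ:V on the infinite map without turn limit. -/
def game (r : Rules) : CivGame State Order (ℕ × Improvement) where
  turn := turn r
  observe := observe
  Valid := Valid

end CivV

/-! ### Civ:VI -/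

namespace CivVI

/-- Constants of the game: the Food a City of a given population has to store in order to grow, the
Production of a City per turn, and the base Faith per turn. -/
structure Rules where
  growthFood : ℕ → ℕ
  production : ℕ
  production_pos : 0 < production
  baseFaith : ℕ

/-- A City: the tile on which it stands, the tiles it owns, its population, the tiles on which its
Citizens work (besides the one who always works the City itself), the stored Food, the cap that the
player has put on its growth (if any), and the Production already put into a Settler. -/
structure City where
  center : Hex
  tiles : List Hex
  population : ℕ
  worked : List Hex
  food : ℕ
  cap : Option ℕ
  settlerProgress : ℕ

/-- Cities as tuples. -/
def City.equiv : City ≃ Hex × List Hex × ℕ × List Hex × ℕ × Option ℕ × ℕ where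
  toFun c := (c.center, c.tiles, c.population, c.worked, c.food, c.cap, c.settlerProgress)
  invFun t := ⟨t.1, t.2.1, t.2.2.1, t.2.2.2.1, t.2.2.2.2.1, t.2.2.2.2.2.1, t.2.2.2.2.2.2⟩
  left_inv _ := rfl
  right_inv _ := rfl

instance : Primcodable City := Primcodable.ofEquiv _ City.equiv

/-- A state of the game: the Cities, the tiles with a Monastery, the tiles with a Farm, the position
of the Worker, and that of the Settler waiting to found a City, if there is one. -/
structure State where
  cities : List City
  monasteries : List Hex
  farms : List Hex
  worker : Hex
  settler : Option Hex

/-- States as tuples. -/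
def State.equiv : State ≃ List City × List Hex × List Hex × Hex × Option Hex where
  toFun s := (s.cities, s.monasteries, s.farms, s.worker, s.settler)
  invFun t := ⟨t.1, t.2.1, t.2.2.1, t.2.2.2.1, t.2.2.2.2⟩
  left_inv _ := rfl
  right_inv _ := rfl

instance : Primcodable State := Primcodable.ofEquiv _ State.equiv

/-- The map: a single infinite strip of grassland, and floodplains everywhere else. -/
def IsGrassland (h : Hex) : Prop := h.2 = 0

instance (h : Hex) : Decidable (IsGrassland h) := inferInstanceAs (Decidable (h.2 = 0))

/-- The Food yield of the terrain of a tile. -/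
def terrainFood (h : Hex) : ℕ := if IsGrassland h then 2 else 3

/-- The Food yield of a worked tile; a Farm adds `1`. -/
def State.tileFood (s : State) (h : Hex) : ℕ := terrainFood h + if h ∈ s.farms then 1 else 0

/-- The Faith yield of a worked tile. -/
def State.tileFaith (s : State) (h : Hex) : ℕ := if h ∈ s.monasteries then 2 else 0

/-- The Faith yield per turn. -/
def State.faith (r : Rules) (s : State) : ℕ :=
  r.baseFaith + (s.cities.map fun c => (c.worked.map s.tileFaith).sum).sum

/-- The Food a City produces per turn: `2` and the terrain of its own tile, and the worked tiles. -/
def State.cityFood (s : State) (c : City) : ℕ :=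
  2 + terrainFood c.center + (c.worked.map s.tileFood).sum

/-- A new Citizen works the free tile of the City with the highest combined yield (and none if no
tile is free). -/
def State.placeCitizen (s : State) (c : City) : City :=
  match (c.tiles.filter fun h => h ≠ c.center ∧ h ∉ c.worked).argmax
      (fun h => s.tileFood h + s.tileFaith h) with
  | some h => { c with worked := h :: c.worked }
  | none => c

/-- The end of a turn for a City. Unless its growth is capped, it stores the Food left over after
every Citizen has consumed `2`, and grows by one Citizen when it has stored enough. -/
def State.grow (r : Rules) (s : State) (c : City) : City :=
  if ∃ k ∈ c.cap, k ≤ c.population then c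
  else
    let f := c.food + (s.cityFood c - 2 * c.population)
    if r.growthFood c.population ≤ f then
      s.placeCitizen { c with population := c.population + 1,
                              food := f - r.growthFood c.population }
    else { c with food := f }

/-- The City that owns a tile. -/
def State.cityAt (s : State) (h : Hex) : Option City := s.cities.find? fun c => h ∈ c.tiles

/-- Replace a City, identified by the tile on which it stands. -/
def State.setCity (s : State) (c : City) : State :=
  { s with cities := s.cities.map fun d => if d.center = c.center then c else d }

/-- In orders, a tile is given by its coordinates or by its offset from the Worker. -/
inductive TileRef
  | absolute (h : Hex)
  | fromWorker (v : Hex)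

/-- The tile referred to. -/
def State.tile (s : State) : TileRef → Hex
  | .absolute h => h
  | .fromWorker v => s.worker + v

/-- Orders to a Settler for one turn. -/
inductive SettlerOrder
  | move (d : HexDir)
  | found

/-- One turn of the Settler. A City is founded on a tile that no City owns, at least `4` hexes away
from all other Cities. It takes the place of the Settler and owns its tile and the
adjacent ones that no City owns yet. It starts with two Citizens: one works the City itself, the
other the tile with the highest combined yield. -/
def settlerTurn (s : State) : SettlerOrder → Option State
  | .move d => do
      let p ← s.settler
      pure { s with settler := some (p + d.vec) }
  | .found => do
      let p ← s.settler
      if s.cityAt p = none ∧ ∀ c ∈ s.cities, 4 ≤ Hex.dist p c.center then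
        let c : City :=
          { center := p
            tiles := p :: (Hex.neighbors p).filter fun h => (s.cityAt h).isNone
            population := 2, worked := [], food := 0, cap := none, settlerProgress := 0 }
        pure { s with cities := s.placeCitizen c :: s.cities, settler := none }
      else none

/-- Move the Citizen working on tile `a` to a free tile `b` of the same City. -/
def reassign (s : State) (a b : Hex) : Option State := do
  let c ← s.cityAt a
  if a ∈ c.worked ∧ b ∈ c.tiles ∧ b ∉ c.worked ∧ b ≠ c.center then
    pure (s.setCity { c with worked := b :: c.worked.erase a })
  else none

/-- Put a cap on the growth of the City that owns tile `a`. -/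
def setCap (s : State) (a : Hex) (k : ℕ) : Option State := do
  let c ← s.cityAt a
  pure (s.setCity { c with cap := some k })

/-- The Production needed for a Settler, which increases with the number of Cities. -/
def State.settlerCost (s : State) : ℕ := 30 * s.cities.length + 50

/-- For one turn, the City that owns tile `a` trains a Settler. The City needs at least two Citizens.
When the Settler is finished it appears in the City, and the City loses the Citizen working on
tile `b`. There is at most one Settler at a time. -/
def train (r : Rules) (s : State) (a b : Hex) : Option State := do
  let c ← s.cityAt a
  if 2 ≤ c.population ∧ b ∈ c.worked ∧ s.settler = none then
    if s.settlerCost ≤ c.settlerProgress + r.production then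
      pure { s.setCity { c with population := c.population - 1, worked := c.worked.erase b,
                                settlerProgress := 0 } with
             settler := some c.center }
    else
      pure (s.setCity { c with settlerProgress := c.settlerProgress + r.production })
  else none

/-- The orders for one turn: a move of the Worker, an order to the Settler, reassignments of
Citizens, caps on the growth of Cities, and the training of a Settler. -/
structure Order where
  worker : Option HexDir
  settler : Option SettlerOrder
  citizens : List (TileRef × TileRef)
  caps : List (TileRef × ℕ)
  train : Option (TileRef × TileRef)

/-- One turn of the game: the orders are carried out, then the Cities grow. -/
def turn (r : Rules) (s : State) (o : Order) : Option State := do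
  let s := match o.worker with
    | some d => { s with worker := s.worker + d.vec }
    | none => s
  let s ← match o.settler with
    | some x => settlerTurn s x
    | none => some s
  let s ← o.citizens.foldlM (fun s x => reassign s (s.tile x.1) (s.tile x.2)) s
  let s ← o.caps.foldlM (fun s x => setCap s (s.tile x.1) x.2) s
  let s ← match o.train with
    | some x => CivVI.train r s (s.tile x.1) (s.tile x.2)
    | none => some s
  pure { s with cities := s.cities.map (s.grow r) }

/-- What the command table refers to: the change of the Faith yield relative to the base yield,
whether the tile of the Worker is being worked, the population of the City that owns this tile and
the position of the Worker relative to that City, and whether there is a Settler. -/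
structure Obs where
  faith : ℕ
  isWorked : Bool
  city : Option (ℕ × Hex)
  settler : Bool
  deriving DecidableEq

/-- What the player observes. -/
def observe (r : Rules) (s : State) : Obs where
  faith := s.faith r - r.baseFaith
  isWorked := s.cities.any fun c => s.worker ∈ c.worked
  city := (s.cityAt s.worker).map fun c => (c.population, s.worker - c.center)
  settler := s.settler.isSome

/-- Consistency of a City: it owns its own tile and further tiles at distance at most `3`; one
Citizen works the City itself, and the others work distinct other tiles owned by the City. -/
structure City.Valid (c : City) : Prop where
  center_mem : c.center ∈ c.tiles
  tiles_nodup : c.tiles.Nodup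
  tiles_dist : ∀ h ∈ c.tiles, Hex.dist h c.center ≤ 3
  worked_nodup : c.worked.Nodup
  worked_tiles : ∀ h ∈ c.worked, h ∈ c.tiles ∧ h ≠ c.center
  population_eq : c.population = c.worked.length + 1

/-- Consistency of a game state: the Cities are consistent, at least `4` hexes apart, and
own disjoint sets of tiles; Monasteries and Farms are on different tiles, off the grassland strip,
that are owned by the player and do not carry a City. -/
structure Valid (s : State) : Prop where
  cities_valid : ∀ c ∈ s.cities, c.Valid
  cities_pairwise : s.cities.Pairwise fun c d =>
    4 ≤ Hex.dist c.center d.center ∧ c.tiles.Disjoint d.tiles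
  disjoint : s.monasteries.Disjoint s.farms
  improved : ∀ h, h ∈ s.monasteries ∨ h ∈ s.farms →
    ¬ IsGrassland h ∧ ∃ c ∈ s.cities, h ∈ c.tiles ∧ h ≠ c.center

/-- Single-player Civ:VI on the infinite map without turn limit. -/
def game (r : Rules) : CivGame State Order Obs where
  turn := turn r
  observe := observe r
  Valid := Valid

end CivVI

open Turing StateTransition Relation in
/-- A finitely supported Turing machine can be renumbered. -/
theorem Turing.TM0.exists_fin_machine {Λ : Type*} [Inhabited Λ] (M : TM0.Machine Bool Λ)
    (S : Finset Λ) (hS : TM0.Supports M (S : Set Λ)) :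
    ∃ (n : ℕ) (M' : TM0.Machine Bool (Fin (n + 1))), ∀ l,
      (StateTransition.eval (TM0.step M') ⟨0, Tape.mk₁ l⟩).Dom ↔ (TM0.eval M l).Dom := by
  classical
  obtain ⟨n, hn⟩ : ∃ n, Fintype.card S = n + 1 :=
    Nat.exists_eq_succ_of_ne_zero (@Fintype.card_ne_zero S _ ⟨⟨default, hS.1⟩⟩)
  let e₀ : S ≃ Fin (n + 1) := Fintype.equivFinOfCardEq hn
  let e : S ≃ Fin (n + 1) := e₀.trans (Equiv.swap (e₀ ⟨default, hS.1⟩) 0)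
  have he : e ⟨default, hS.1⟩ = 0 := by simp [e]
  let g₁ : PointedMap Λ (Fin (n + 1)) :=
    ⟨fun q => if h : q ∈ S then e ⟨q, h⟩ else 0, by
      rw [dif_pos (show (default : Λ) ∈ S from hS.1)]; exact he⟩
  let g₂ : Fin (n + 1) → Λ := fun i => (e.symm i : Λ)
  let f : PointedMap Bool Bool := ⟨id, rfl⟩
  refine ⟨n, TM0.Machine.map M f f g₁ g₂, fun l => ?_⟩
  have hg : ∀ q ∈ (S : Set Λ), g₂ (g₁ q) = q := by
    intro q hq
    have : g₁ q = e ⟨q, hq⟩ := dif_pos (show q ∈ S from hq)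
    simp [g₂, this]
  have H := TM0.Machine.map_respects M f f g₁ g₂ hS (fun _ => rfl) hg
  have h0 := TM0.map_init f g₁ l
  have := tr_eval_dom H (a₁ := TM0.init l) (a₂ := TM0.init (l.map f)) ⟨hS.1, h0⟩
  have hl : l.map f = l := List.map_id l
  rw [hl] at this
  exact this

open Turing StateTransition in
theorem Turing.TM1to1.trTape_mk₁ {Γ : Type*} [Inhabited Γ] {n : ℕ} {enc : Γ → List.Vector Bool n}
    (enc0 : enc default = List.Vector.replicate n false) (l : List Γ) :
    TM1to1.trTape enc0 (Tape.mk₁ l) = Tape.mk₁ (l.flatMap fun a => (enc a).toList) := by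
  rw [Tape.mk₁, Tape.mk₂, TM1to1.trTape_mk', TM1to1.trTape', Tape.mk₁, Tape.mk₂]
  rw [ListBlank.flatMap_mk, ListBlank.flatMap_mk]
  rfl

open Turing StateTransition in
/-- A finitely supported Turing machine can be turned into one with two symbols and finitely many
states, whose input is obtained by replacing each symbol by a word. -/
theorem Turing.TM1.exists_bool_machine {Γ Λ σ : Type*} [Inhabited Γ] [Fintype Γ] [Inhabited Λ]
    [Inhabited σ] [Fintype σ] (M : Λ → TM1.Stmt Γ Λ σ) (S : Finset Λ) (hS : TM1.Supports M S) :
    ∃ (n : ℕ) (M' : TM0.Machine Bool (Fin (n + 1))) (w : Γ → List Bool), ∀ l,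
      (StateTransition.eval (TM0.step M') ⟨0, Tape.mk₁ (l.flatMap w)⟩).Dom ↔
        (TM1.eval M l).Dom := by
  classical
  obtain ⟨n, enc, dec, enc0, encdec⟩ := TM1to1.exists_enc_dec (Γ := Γ)
  let M₁ := TM1to1.tr enc dec M
  have hM₁ : TM1.Supports M₁ (TM1to1.trSupp M S) := TM1to1.tr_supports enc dec M hS
  obtain ⟨k, M', hM'⟩ := TM0.exists_fin_machine (TM1to0.tr M₁) _ (TM1to0.tr_supports M₁ hM₁)
  refine ⟨k, M', fun a => (enc a).toList, fun l => ?_⟩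
  rw [hM', TM1to0.tr_eval]
  have h0 : TM1to1.trCfg enc enc0 (TM1.init l : TM1.Cfg Γ Λ σ) =
      TM1.init (l.flatMap fun a => (enc a).toList) := by
    simp only [TM1to1.trCfg, TM1.init, TM1to1.trTape_mk₁ enc0]
    rfl
  exact tr_eval_dom (TM1to1.tr_respects dec M encdec) h0

open Turing in
theorem Turing.PartrecToTM2.trPosNum_eq (p : PosNum) : PartrecToTM2.trPosNum p =
    (p : ℕ).bits.map fun b => cond b PartrecToTM2.Γ'.bit1 .bit0 := by
  induction p with
  | one => simp [PartrecToTM2.trPosNum, Nat.one_bits]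
  | bit0 p ih =>
    have h : ((p.bit0 : PosNum) : ℕ) = 2 * (p : ℕ) := by
      rw [PosNum.cast_bit0]; ring
    rw [PartrecToTM2.trPosNum, h, Nat.bit0_bits _ (PosNum.to_nat_pos p).ne', ih]
    rfl
  | bit1 p ih =>
    have h : ((p.bit1 : PosNum) : ℕ) = 2 * (p : ℕ) + 1 := by
      rw [PosNum.cast_bit1]; ring
    rw [PartrecToTM2.trPosNum, h, Nat.bit1_bits, ih]
    rfl

open Turing in
theorem Turing.PartrecToTM2.trNat_eq (n : ℕ) :
    PartrecToTM2.trNat n = n.bits.map fun b => cond b PartrecToTM2.Γ'.bit1 .bit0 := by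
  have h := Num.to_of_nat n
  rw [PartrecToTM2.trNat]
  conv_rhs => rw [← h]
  cases (n : Num) with
  | zero => simp [PartrecToTM2.trNum]
  | pos p => exact PartrecToTM2.trPosNum_eq p

instance : Fintype Turing.PartrecToTM2.K' :=
  ⟨{.main, .rev, .aux, .stack}, fun k => by cases k <;> decide⟩

open Turing StateTransition in
/-- Every partial recursive function has its domain recognised by a Turing machine with two symbols
and finitely many states; the input is written in binary. -/
theorem Turing.exists_bool_machine_of_partrec {f : ℕ →. ℕ} (hf : Partrec f) :
    ∃ (n : ℕ) (M : TM0.Machine Bool (Fin (n + 1))) (w : Bool → List Bool) (v : List Bool), ∀ m,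
      (StateTransition.eval (TM0.step M) ⟨0, Tape.mk₁ (v ++ m.bits.reverse.flatMap w)⟩).Dom ↔
        (f m).Dom := by
  obtain ⟨c, hc⟩ := ToPartrec.Code.exists_code (Nat.Partrec'.part_iff₁.2 hf)
  let q₀ := PartrecToTM2.trNormal c .halt
  let : Inhabited PartrecToTM2.Λ' := ⟨q₀⟩
  have hS := TM2to1.tr_supports PartrecToTM2.tr (PartrecToTM2.tr_supports c .halt)
  obtain ⟨n, M, w, hM⟩ := TM1.exists_bool_machine _ _ hS
  let sym : PartrecToTM2.Γ' → ∀ _ : PartrecToTM2.K', Option PartrecToTM2.Γ' :=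
    fun a => Function.update (fun _ => none) .main (some a)
  refine ⟨n, M, fun b => w (false, sym (cond b .bit1 .bit0)), w (true, sym .cons), fun m => ?_⟩
  have key : (TM2.eval PartrecToTM2.tr PartrecToTM2.K'.main (PartrecToTM2.trList [m])).Dom ↔
      (f m).Dom := by
    have h := PartrecToTM2.tr_eval c [m]
    have h2 := hc ⟨[m], rfl⟩
    have h3 : (TM2.init PartrecToTM2.K'.main (PartrecToTM2.trList [m]) :
        TM2.Cfg (fun _ : PartrecToTM2.K' => PartrecToTM2.Γ') PartrecToTM2.Λ'
          (Option PartrecToTM2.Γ')) = PartrecToTM2.init c [m] := by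
      simp only [TM2.init, PartrecToTM2.init]
      congr 1
      funext k
      cases k <;> rfl
    change (StateTransition.eval (TM2.step PartrecToTM2.tr) (TM2.init _ _)).Dom ↔ _
    rw [h3, h, h2]
    rfl
  have h4 := (hM (TM2to1.trInit PartrecToTM2.K'.main (PartrecToTM2.trList [m]))).trans
    ((TM2to1.tr_eval_dom PartrecToTM2.tr PartrecToTM2.K'.main (PartrecToTM2.trList [m])).trans key)
  rw [← h4]
  have h5 : TM2to1.trInit PartrecToTM2.K'.main (PartrecToTM2.trList [m]) =
      (true, sym .cons) :: m.bits.reverse.map fun b => (false, sym (cond b .bit1 .bit0)) := by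
    have hr : (PartrecToTM2.trList [m]).reverse = .cons :: m.bits.reverse.map fun b =>
        cond b PartrecToTM2.Γ'.bit1 .bit0 := by
      simp [PartrecToTM2.trNat_eq]
    unfold TM2to1.trInit
    rw [hr]
    exact congrArg (List.cons _) (List.map_map ..)
  rw [h5]
  have h6 : ∀ l : List Bool, (l.map fun b => ((false, sym (cond b .bit1 .bit0)) :
      TM2to1.Γ' PartrecToTM2.K' fun _ => PartrecToTM2.Γ')).flatMap w =
      l.flatMap fun b => w (false, sym (cond b .bit1 .bit0)) := fun l => List.flatMap_map _ _ l
  rw [← h6]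
  rfl

theorem Primrec.nat_bits : Primrec Nat.bits := by
  have : Primrec fun H : List (List Bool) =>
      if H.length = 0 then some []
      else (H[H.length / 2]?).map fun l => Nat.bodd H.length :: l := by
    refine Primrec.ite (Primrec.eq.comp Primrec.list_length (Primrec.const 0)) (Primrec.const _) ?_
    refine Primrec.option_map (Primrec.list_getElem?.comp Primrec.id
      (Primrec.nat_div.comp Primrec.list_length (Primrec.const 2))) ?_
    exact Primrec.list_cons.comp (Primrec.nat_bodd.comp (Primrec.list_length.comp Primrec.fst))
      Primrec.snd
  have h := Primrec.nat_strong_rec (fun (_ : Unit) n => Nat.bits n) (this.comp Primrec.snd).to₂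
    fun _ n => ?_
  · exact h.comp (Primrec.const ()) Primrec.id
  · rcases Nat.eq_zero_or_pos n with rfl | hn
    · simp
    · have : n / 2 < n := Nat.div_lt_self hn one_lt_two
      simp only [List.length_map, List.length_range, hn.ne', if_false]
      rw [List.getElem?_map, List.getElem?_range this]
      simp only [Option.map_some]
      congr 1
      conv_rhs => rw [← Nat.bit_bodd_div2 n]
      rw [Nat.bits_append_bit, Nat.div2_val]
      intro h
      rw [Nat.div2_val] at h
      by_contra hb
      have := Nat.bodd_add_div2 n
      rw [Nat.div2_val, h] at this
      simp at hb
      simp [hb] at this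
      omega

open Turing in
/-- There is a universal Turing machine with two symbols and finitely many states. -/
theorem Turing.exists_universal_bool_machine :
    ∃ (n : ℕ) (M : TM0.Machine Bool (Fin (n + 1))) (inp : Nat.Partrec.Code → ℕ → List Bool),
      Computable₂ inp ∧ ∀ c m,
      (StateTransition.eval (TM0.step M) ⟨0, Tape.mk₁ (inp c m)⟩).Dom ↔ (c.eval m).Dom := by
  let f : ℕ →. ℕ := fun m =>
    ((Encodable.decode m.unpair.1 : Option Nat.Partrec.Code).getD .zero).eval m.unpair.2
  have hf : Partrec f := by
    refine Nat.Partrec.Code.eval_part.comp (Computable.option_getD (Computable.decode.comp ?_)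
      (Computable.const _)) ?_
    · exact (Primrec.fst.comp Primrec.unpair).to_comp
    · exact (Primrec.snd.comp Primrec.unpair).to_comp
  obtain ⟨n, M, w, v, h⟩ := exists_bool_machine_of_partrec hf
  refine ⟨n, M, fun c m => v ++ (Nat.pair (Encodable.encode c) m).bits.reverse.flatMap w, ?_,
    fun c m => ?_⟩
  · have hw : Primrec w := Primrec.dom_finite w
    refine Primrec.to_comp (Primrec.list_append.comp (Primrec.const v) (Primrec.list_flatMap
      (Primrec.list_reverse.comp (Primrec.nat_bits.comp
        (Primrec₂.natPair.comp (Primrec.encode.comp Primrec.fst) Primrec.snd))) ?_))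
    exact hw.comp Primrec.snd
  · rw [h]
    simp [f]


theorem List.lookup_filterMap_map {α κ β : Type*} [BEq β] [LawfulBEq β] (obs : κ → β)
    (hobs : Function.Injective obs) (cmd : κ → Option α) (keys : List κ) (k : κ) (hk : k ∈ keys) :
    (keys.filterMap fun k => (cmd k).map (Prod.mk (obs k))).lookup (obs k) = cmd k := by
  classical
  have aux : ∀ keys : List κ, (keys.filterMap fun k => (cmd k).map (Prod.mk (obs k))).lookup (obs k)
      = if k ∈ keys then cmd k else none := by
    intro keys
    induction keys with
    | nil => simp
    | cons k' keys ih =>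
      rw [List.filterMap_cons]
      by_cases h : k = k'
      · subst h
        cases hc : cmd k with
        | none => simp [ih, hc]
        | some => simp
      · have h' : obs k ≠ obs k' := fun e => h (hobs e)
        cases hc : cmd k' <;> simp [ih, h, List.lookup_cons, beq_eq_false_iff_ne.2 h']
  rw [aux, if_pos hk]

theorem List.lookup_map_range {β γ : Type*} [BEq β] [LawfulBEq β] (k : ℕ → β)
    (hk : Function.Injective k) (v : ℕ → γ) (n i : ℕ) :
    ((List.range n).map fun i => (k i, v i)).lookup (k i) = if i < n then some (v i) else none := by
  induction n with
  | zero => simp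
  | succ n ih =>
    rw [List.range_succ, List.map_append, List.lookup_append, ih]
    rcases lt_trichotomy i n with h | rfl | h
    · simp [h, h.trans (Nat.lt_succ_self n)]
    · simp
    · have hki : (k i == k n) = false := beq_eq_false_iff_ne.2 fun e => h.ne' (hk e)
      simp [List.lookup_cons, hki, h.not_gt, show ¬ i < n + 1 by omega]

theorem List.lookup_map_range_of_ne {β γ : Type*} [BEq β] [LawfulBEq β] (k : ℕ → β)
    (v : ℕ → γ) (n : ℕ) (b : β) (h : ∀ i, k i ≠ b) :
    ((List.range n).map fun i => (k i, v i)).lookup b = none := by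
  rw [List.lookup_eq_none_iff]
  simp only [List.mem_map, bne_iff_ne]
  rintro _ ⟨i, -, rfl⟩ e
  exact h i (by simpa using e.symm)

theorem Turing.Tape.mk₁_nth_natCast {Γ : Type*} [Inhabited Γ] (l : List Γ) (n : ℕ) :
    (Turing.Tape.mk₁ l).nth n = l.getI n := by
  rw [Tape.mk₁, Tape.mk₂, Tape.mk'_nth_nat, ListBlank.nth_mk]

theorem Turing.Tape.mk₁_nth_of_neg {Γ : Type*} [Inhabited Γ] (l : List Γ) {x : ℤ} (hx : x < 0) :
    (Turing.Tape.mk₁ l).nth x = default := by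
  obtain ⟨n, rfl⟩ := Int.eq_negSucc_of_lt_zero hx
  change ((Turing.ListBlank.mk ([] : List Γ))).nth n = default
  rw [ListBlank.nth_mk]
  rfl

theorem Primrec.int_natCast : Primrec (Nat.cast : ℕ → ℤ) := by
  refine Primrec.encode_iff.1
    ((Primrec.nat_mul.comp (Primrec.const 2) Primrec.id).of_eq fun n => ?_)
  rfl

namespace CivGame

section

variable {State Order Obs : Type} {G : CivGame State Order Obs}

/-- Carrying out the orders `os` leads from `s` to `s'`. -/
def Run (G : CivGame State Order Obs) (os : List Order) (s s' : State) : Prop :=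
  os.foldlM G.turn s = some s'

theorem Run.append {os os' : List Order} {s s' s'' : State} (h : G.Run os s s')
    (h' : G.Run os' s' s'') : G.Run (os ++ os') s s'' := by
  unfold Run at *
  rw [List.foldlM_append, h]
  exact h'

theorem Run.nil (s : State) : G.Run [] s s := rfl

theorem Run.single {o : Order} {s s' : State} (h : G.turn s o = some s') : G.Run [o] s s' := by
  simp [Run, h]

open Turing in
/-- A way to operate a counter with values up to `N` and a tape by orders in a game. -/
structure TapeInterface (G : CivGame State Order Obs) (N : ℕ) where
  R : ℕ → Tape Bool → State → Prop
  obs : ℕ × Bool → Obs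
  obs_injective : Function.Injective obs
  inc : List Order
  dec : List Order
  move : Dir → List Order
  write : Bool → List Order
  observe_eq : ∀ {k T s}, R k T s → G.observe s = obs (k, T.head)
  run_inc : ∀ {k T s}, R k T s → k < N → ∃ s', G.Run inc s s' ∧ R (k + 1) T s'
  run_dec : ∀ {k T s}, R (k + 1) T s → ∃ s', G.Run dec s s' ∧ R k T s'
  run_move : ∀ {k T s} (d : Dir), R k T s → ∃ s', G.Run (move d) s s' ∧ R k (T.move d) s'
  run_write : ∀ {k T s} (a : Bool), R k T s → T.head ≠ a →
    ∃ s', G.Run (write a) s s' ∧ R k (T.write a) s'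

namespace TapeInterface

variable {n : ℕ} (I : TapeInterface G n)

open Turing

/-- Orders that change the value of the counter. -/
def setCounter (k k' : ℕ) : List Order :=
  (List.replicate k I.dec).flatten ++ (List.replicate k' I.inc).flatten

theorem run_setCounter {k k' : ℕ} {T : Tape Bool} {s : State} (h : I.R k T s) (hk : k' ≤ n) :
    ∃ s', G.Run (I.setCounter k k') s s' ∧ I.R k' T s' := by
  have h₁ : ∃ s', G.Run (List.replicate k I.dec).flatten s s' ∧ I.R 0 T s' := by
    induction k generalizing s with
    | zero => exact ⟨s, .nil s, h⟩
    | succ k ih =>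
      obtain ⟨s₁, h₁, h₂⟩ := I.run_dec h
      obtain ⟨s₂, h₃, h₄⟩ := ih h₂
      exact ⟨s₂, by rw [List.replicate_succ, List.flatten_cons]; exact h₁.append h₃, h₄⟩
  obtain ⟨s₁, h₁, h₂⟩ := h₁
  have h₃ : ∃ s', G.Run (List.replicate k' I.inc).flatten s₁ s' ∧ I.R k' T s' := by
    induction k' with
    | zero => exact ⟨s₁, .nil s₁, h₂⟩
    | succ k' ih =>
      obtain ⟨s₂, h₃, h₄⟩ := ih (by omega)
      obtain ⟨s₃, h₅, h₆⟩ := I.run_inc h₄ (by omega)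
      refine ⟨s₃, ?_, h₆⟩
      rw [List.replicate_succ', List.flatten_append]
      exact h₃.append (by simpa using h₅)
  obtain ⟨s₂, h₃, h₄⟩ := h₃
  exact ⟨s₂, h₁.append h₃, h₄⟩

/-- Orders that carry out an action of a Turing machine. -/
def act (b : Bool) : TM0.Stmt Bool → List Order
  | .move d => I.move d
  | .write a => if b = a then [] else I.write a

theorem run_act {k : ℕ} {T : Tape Bool} {s : State} (h : I.R k T s) (a : TM0.Stmt Bool) :
    ∃ s', G.Run (I.act T.head a) s s' ∧ I.R k (match a with
      | .move d => T.move d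
      | .write a => T.write a) s' := by
  cases a with
  | move d => exact I.run_move d h
  | write a =>
    by_cases e : T.head = a
    · subst e
      exact ⟨s, by simp [act, Run], by simpa using h⟩
    · simpa [act, e] using I.run_write a h e

end TapeInterface

end

variable {State Order Obs : Type} [DecidableEq Obs] {G : CivGame State Order Obs}
  {T : CommandTable Obs Order}

theorem Run.round {os : List Order} {s s' : State} (h : G.Run os s s')
    (hT : T.lookup (G.observe s) = some os) : G.Round T s s' := ⟨os, hT, h⟩

/-- A game that simulates every step of a deterministic process, and halts when the process
does, halts if and only if the process does. -/
theorem halts_iff_of_simulation {σ : Type*} (f : σ → Option σ) (R : σ → State → Prop)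
    (hstep : ∀ c c' s, f c = some c' → R c s → ∃ s', Relation.TransGen (G.Round T) s s' ∧ R c' s')
    (hhalt : ∀ c s, f c = none → R c s → T.lookup (G.observe s) = none)
    {c : σ} {s : State} (h : R c s) : G.Halts T s ↔ (StateTransition.eval f c).Dom := by
  let g : State → Option State := fun s =>
    (T.lookup (G.observe s)).map fun os => (os.foldlM G.turn s).getD s
  have hg : ∀ {s s'}, G.Round T s s' → s' ∈ g s := by
    rintro s s' ⟨os, h₁, h₂⟩
    simp [g, h₁, h₂]
  constructor
  · rintro ⟨s', h₁, h₂⟩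
    have hd : (StateTransition.eval g s).Dom :=
      Part.dom_iff_mem.2 ⟨s', StateTransition.mem_eval.2
        ⟨Relation.ReflTransGen.mono (fun _ _ => hg) _ _ h₁, by simp [g, h₂]⟩⟩
    refine (StateTransition.tr_eval_dom (f₁ := f) (tr := R) ?_ h).1 hd
    intro c s hc
    cases e : f c with
    | none => simp [g, hhalt c s e hc]
    | some c' =>
      obtain ⟨s', h₁, h₂⟩ := hstep c c' s e hc
      exact ⟨s', h₂, Relation.TransGen.mono (fun _ _ => hg) _ _ h₁⟩
  · intro hd
    obtain ⟨c', hc'⟩ := Part.dom_iff_mem.1 hd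
    obtain ⟨h₁, h₂⟩ := StateTransition.mem_eval.1 hc'
    have : ∃ s', Relation.ReflTransGen (G.Round T) s s' ∧ R c' s' := by
      clear h₂ hc'
      induction h₁ with
      | refl => exact ⟨s, .refl, h⟩
      | tail _ h₂ ih =>
        obtain ⟨s₁, h₃, h₄⟩ := ih
        obtain ⟨s₂, h₅, h₆⟩ := hstep _ _ _ h₂ h₄
        exact ⟨s₂, h₃.trans h₅.to_reflTransGen, h₆⟩
    obtain ⟨s', h₃, h₄⟩ := this
    exact ⟨s', h₃, hhalt _ _ h₂ h₄⟩

theorem SimulatesUniversal.undecidableUnder [Primcodable State] (h : G.SimulatesUniversal T) :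
    G.UndecidableUnder T := by
  obtain ⟨enc, henc, h⟩ := h
  rintro ⟨f, hf, hfs⟩
  refine ComputablePred.halting_problem 0 (ComputablePred.computable_iff.2
    ⟨fun c => f (enc c 0), hf.comp (henc.comp .id (.const 0)), ?_⟩)
  funext c
  exact propext ((h c 0).2.symm.trans (hfs _ (h c 0).1).symm)

/-- The game halts under the table whenever the machine does, from states that represent its
configurations. -/
theorem exists_simulatesUniversal [Primcodable State]
    (h : ∀ (n : ℕ) (M : Turing.TM0.Machine Bool (Fin (n + 1))), ∃ (T : CommandTable Obs Order)
      (init : List Bool → State), Computable init ∧ ∀ l, G.Valid (init l) ∧ (G.Halts T (init l) ↔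
        (StateTransition.eval (Turing.TM0.step M) ⟨0, Turing.Tape.mk₁ l⟩).Dom)) :
    ∃ T : CommandTable Obs Order, G.SimulatesUniversal T ∧ G.UndecidableUnder T := by
  obtain ⟨n, M, inp, hinp, hM⟩ := Turing.exists_universal_bool_machine
  obtain ⟨T, init, hinit, hT⟩ := h n M
  have : G.SimulatesUniversal T :=
    ⟨fun c m => init (inp c m), hinit.comp hinp, fun c m =>
      ⟨(hT _).1, (hT _).2.trans (hM c m)⟩⟩
  exact ⟨T, this, this.undecidableUnder⟩

/-- The table that assigns to each observation `obs k` the command `cmd k`. -/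
noncomputable def mkTable {κ : Type} [Fintype κ] (obs : κ → Obs)
    (cmd : κ → Option (List Order)) : CommandTable Obs Order :=
  Finset.univ.toList.filterMap fun k => (cmd k).map (Prod.mk (obs k))

theorem lookup_mkTable {κ : Type} [Fintype κ] {obs : κ → Obs} (hobs : Function.Injective obs)
    (cmd : κ → Option (List Order)) (k : κ) : (mkTable obs cmd).lookup (obs k) = cmd k :=
  List.lookup_filterMap_map obs hobs cmd _ k (by simp)

namespace TapeInterface

variable {n : ℕ} (I : TapeInterface G n)

open Turing

/-- The command for a Turing machine in state `k.1` that reads `k.2`. -/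
def command (M : TM0.Machine Bool (Fin (n + 1))) (k : Fin (n + 1) × Bool) : Option (List Order) :=
  (M k.1 k.2).map fun x => I.setCounter k.1 x.1 ++ I.act k.2 x.2

theorem exists_table (M : TM0.Machine Bool (Fin (n + 1))) : ∃ T : CommandTable Obs Order,
    ∀ (c : TM0.Cfg Bool (Fin (n + 1))) (s : State), I.R c.q c.Tape s →
      (G.Halts T s ↔ (StateTransition.eval (TM0.step M) c).Dom) := by
  let obs : Fin (n + 1) × Bool → Obs := fun k => I.obs (k.1, k.2)
  have hobs : Function.Injective obs := by
    rintro ⟨k, b⟩ ⟨k', b'⟩ h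
    have := I.obs_injective h
    simp only [Prod.mk.injEq] at this
    exact Prod.ext (Fin.ext this.1) this.2
  refine ⟨mkTable obs (I.command M), fun c s h => halts_iff_of_simulation (TM0.step M)
    (fun c s => I.R c.q c.Tape s) ?_ ?_ h⟩
  · rintro ⟨q, T⟩ c' s hc hR
    simp only [TM0.step, Option.map_eq_some_iff] at hc
    obtain ⟨⟨q', a⟩, hM, rfl⟩ := hc
    obtain ⟨s₁, h₁, h₂⟩ := I.run_setCounter hR (Nat.lt_succ_iff.1 q'.2)
    obtain ⟨s₂, h₃, h₄⟩ := I.run_act h₂ a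
    refine ⟨s₂, .single ((h₁.append h₃).round ?_), by cases a <;> exact h₄⟩
    rw [I.observe_eq hR]
    refine (lookup_mkTable hobs _ (q, T.head)).trans ?_
    simp [command, hM]
  · rintro ⟨q, T⟩ s hc hR
    simp only [TM0.step, Option.map_eq_none_iff] at hc
    rw [I.observe_eq hR]
    refine (lookup_mkTable hobs _ (q, T.head)).trans ?_
    simp [command, hc]

end TapeInterface

theorem exists_simulatesUniversal_of_tapeInterface [Primcodable State]
    (h : ∀ n : ℕ, ∃ (I : TapeInterface G n) (init : List Bool → State), Computable init ∧
      ∀ l, G.Valid (init l) ∧ I.R 0 (Turing.Tape.mk₁ l) (init l)) :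
    ∃ T : CommandTable Obs Order, G.SimulatesUniversal T ∧ G.UndecidableUnder T := by
  refine exists_simulatesUniversal fun n M => ?_
  obtain ⟨I, init, hinit, hI⟩ := h n
  obtain ⟨T, hT⟩ := I.exists_table M
  exact ⟨T, init, hinit, fun l => ⟨(hI l).1, hT ⟨0, Turing.Tape.mk₁ l⟩ _ (hI l).2⟩⟩

end CivGame

theorem Worker.work_eq {Project : Type} [DecidableEq Project] (w : Worker Project) (p : Project)
    (cost : ℕ) : w.work p cost = (⟨w.pos, none⟩, true) ∨
      ∃ j, w.work p cost = (⟨w.pos, j⟩, false) := by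
  unfold Worker.work
  dsimp only
  split_ifs
  · exact .inl rfl
  · exact .inr ⟨_, rfl⟩

/-- Giving the order to build on enough consecutive turns completes the construction. -/
theorem Worker.foldlM_build {State Order Project : Type} [DecidableEq Project]
    (turn : State → Order → Option State) (o : Order) (S : Option (Project × ℕ) → State)
    (s' : State) (p : Project) (cost : ℕ) (h : Hex)
    (H : ∀ j, turn (S j) o = some (if ((⟨h, j⟩ : Worker Project).work p cost).2 then s'
      else S ((⟨h, j⟩ : Worker Project).work p cost).1.job)) :
    (List.replicate (max cost 1) o).foldlM turn (S none) = some s' := by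
  have aux : ∀ m k j, ((j = none ∧ k = 0) ∨ j = some (p, k)) → k + m + 1 = max cost 1 →
      (List.replicate (m + 1) o).foldlM turn (S j) = some s' := by
    intro m
    induction m with
    | zero =>
      intro k j hj hk
      have : cost ≤ k + 1 := by omega
      rcases hj with ⟨rfl, rfl⟩ | rfl <;> simp [H, Worker.work, this]
    | succ m ih =>
      intro k j hj hk
      have hc : ¬ cost ≤ k + 1 := by omega
      rw [List.replicate_succ, List.foldlM_cons]
      have : turn (S j) o = some (S (some (p, k + 1))) := by
        rw [H]
        rcases hj with ⟨rfl, rfl⟩ | rfl <;> simp [Worker.work, hc]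
      rw [this]
      exact ih (k + 1) _ (.inr rfl) (by omega)
  obtain ⟨m, hm⟩ : ∃ m, max cost 1 = m + 1 := ⟨max cost 1 - 1, by omega⟩
  rw [hm]
  exact aux m 0 none (.inl ⟨rfl, rfl⟩) (by omega)

/-- The direction on the map that corresponds to a direction on the tape. -/
def Turing.Dir.toHexDir : Turing.Dir → HexDir
  | .left => .west
  | .right => .east


namespace CivBE

/-- The tiles on which the value of the counter is recorded. -/
def counterTiles (n : ℕ) : List Hex := (List.range n).map fun j : ℕ => ((j : ℤ), (1 : ℤ))

theorem State.improvementAt_setImprovement (s : State) (h h' : Hex) (i : Improvement) :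
    (s.setImprovement h i).improvementAt h' = if h' = h then i else s.improvementAt h' := by
  by_cases e : h' = h
  · subst e
    simp [improvementAt, setImprovement]
  · simp [improvementAt, setImprovement, List.lookup_cons, beq_eq_false_iff_ne.2 e, e]

/-- The symbols on the tape. -/
def symbol : Bool → Improvement
  | false => .unimproved
  | true => .road

open Turing in
/-- The state `s` records the number `k` by Terrascapes and the tape `T` by Roads. -/
structure Represents (n k : ℕ) (T : Tape Bool) (s : State) : Prop where
  desert : s.desert = counterTiles n
  owned : s.owned = counterTiles n
  worked : s.worked = counterTiles n
  terraforming : s.terraforming = true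
  ecoscaping : s.ecoscaping = true
  le : k ≤ n
  counter : ∀ j : ℕ, s.improvementAt (j, 1) = if j < k then .terrascape else .unimproved
  stateWorker : s.stateWorker = ⟨(k, 1), none⟩
  tape : ∃ p : ℤ, s.tapeWorker = ⟨(p, 0), none⟩ ∧
    ∀ x, s.improvementAt (x, 0) = symbol (T.nth (x - p))

theorem mem_counterTiles {n j : ℕ} (h : j < n) : ((j : ℤ), (1 : ℤ)) ∈ counterTiles n :=
  List.mem_map.2 ⟨j, List.mem_range.2 h, rfl⟩

theorem counterTiles_nodup (n : ℕ) : (counterTiles n).Nodup :=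
  List.nodup_range.map fun i j h => by simpa using h

variable {n k : ℕ} {T : Turing.Tape Bool} {s : State} (r : Rules)

theorem Represents.observe_eq (h : Represents n k T s) :
    observe r s = ((r.terrascapeCulture + 1) * k, symbol T.head) := by
  obtain ⟨p, hp, ht⟩ := h.tape
  have h₁ : (s.worked.countP fun h => s.improvementAt h = .terrascape) = k := by
    rw [h.worked, counterTiles, List.countP_map]
    have : ((fun h => decide (s.improvementAt h = .terrascape)) ∘ fun j : ℕ => ((j : ℤ), (1 : ℤ))) =
        fun j => decide (j < k) := by
      funext j
      simp only [Function.comp_apply, h.counter j]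
      by_cases hj : j < k <;> simp [hj]
    rw [this, List.countP_eq_length_filter]
    have hle := h.le
    obtain ⟨m, rfl⟩ := Nat.exists_eq_add_of_le hle
    rw [List.range_add, List.filter_append, List.filter_eq_self.2, List.filter_eq_nil_iff.2]
    · simp
    · simp
    · simp
  simp only [observe, State.culture, h₁, h.ecoscaping, hp, ht]
  simp

/-- Orders only for the Worker on the tiles of the counter. -/
def counterOrder (o : WorkerOrder) : Order := ⟨o, .wait, .wait⟩

/-- Orders only for the Worker on the tape. -/
def tapeOrder (o : WorkerOrder) : Order := ⟨.wait, o, .wait⟩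

theorem turn_counterOrder (s : State) (o : WorkerOrder) : turn r s (counterOrder o) =
    (workerTurn r s s.stateWorker o).map fun x => { x.1 with stateWorker := x.2 } := by
  simp only [turn, counterOrder]
  cases workerTurn r s s.stateWorker o <;> rfl

theorem turn_tapeOrder (s : State) (o : WorkerOrder) : turn r s (tapeOrder o) =
    (workerTurn r s s.tapeWorker o).map fun x => { x.1 with tapeWorker := x.2 } := by
  have : turn r s (tapeOrder o) = (workerTurn r s s.tapeWorker o).bind fun x =>
    some { x.1 with tapeWorker := x.2 } := rfl
  rw [this]
  cases workerTurn r s s.tapeWorker o <;> rfl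

theorem turn_counterOrder_build {s : State} {h : Hex} (h₁ : s.improvementAt h = .unimproved)
    (h₂ : h ∈ s.owned) (h₃ : h ∈ s.desert) (h₄ : s.terraforming = true)
    (h₅ : s.stateWorker = ⟨h, none⟩) :
    (game r).Run (List.replicate (max r.terrascapeTurns 1) (counterOrder (.build .terrascape))) s
      (s.setImprovement h .terrascape) := by
  have hb := Worker.foldlM_build (game r).turn (counterOrder (.build .terrascape))
    (fun j => { s with stateWorker := ⟨h, j⟩ })
    { s.setImprovement h .terrascape with stateWorker := ⟨h, none⟩ }
    .terrascape r.terrascapeTurns h (fun j => by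
      change turn r _ _ = _
      rw [turn_counterOrder]
      change Option.map _ (if s.improvementAt h = .unimproved ∧ h ∈ s.owned ∧
        h ∈ s.desert ∧ s.terraforming = true then _ else none) = _
      rw [if_pos ⟨h₁, h₂, h₃, h₄⟩]
      dsimp only
      rcases (⟨h, j⟩ : Worker Project).work_eq .terrascape r.terrascapeTurns with
        hx | ⟨j', hx⟩ <;> rw [hx] <;> rfl)
  rw [← h₅] at hb
  exact hb

theorem turn_tapeOrder_build {s : State} {h : Hex} (h₁ : s.improvementAt h = .unimproved)
    (h₅ : s.tapeWorker = ⟨h, none⟩) :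
    (game r).Run (List.replicate (max r.roadTurns 1) (tapeOrder (.build .road))) s
      (s.setImprovement h .road) := by
  have hb := Worker.foldlM_build (game r).turn (tapeOrder (.build .road))
    (fun j => { s with tapeWorker := ⟨h, j⟩ })
    { s.setImprovement h .road with tapeWorker := ⟨h, none⟩ }
    .road r.roadTurns h (fun j => by
      change turn r _ _ = _
      rw [turn_tapeOrder]
      change Option.map _ (if s.improvementAt h = .unimproved then _ else none) = _
      rw [if_pos h₁]
      dsimp only
      rcases (⟨h, j⟩ : Worker Project).work_eq .road r.roadTurns with
        hx | ⟨j', hx⟩ <;> rw [hx] <;> rfl)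
  rw [← h₅] at hb
  exact hb

theorem turn_tapeOrder_remove {s : State} {h : Hex} (h₁ : s.improvementAt h ≠ .unimproved)
    (h₅ : s.tapeWorker = ⟨h, none⟩) :
    turn r s (tapeOrder .remove) = some (s.setImprovement h .unimproved) := by
  have h₆ : s.improvementAt s.tapeWorker.pos ≠ .unimproved := by rwa [h₅]
  rw [turn_tapeOrder]
  change Option.map _ (if s.improvementAt s.tapeWorker.pos ≠ .unimproved then _ else none) = _
  rw [if_pos h₆]
  cases s
  cases h₅
  rfl

theorem turn_counterOrder_remove {s : State} {h : Hex} (h₁ : s.improvementAt h ≠ .unimproved)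
    (h₅ : s.stateWorker = ⟨h, none⟩) :
    turn r s (counterOrder .remove) = some (s.setImprovement h .unimproved) := by
  have h₆ : s.improvementAt s.stateWorker.pos ≠ .unimproved := by rwa [h₅]
  rw [turn_counterOrder]
  change Option.map _ (if s.improvementAt s.stateWorker.pos ≠ .unimproved then _ else none) = _
  rw [if_pos h₆]
  cases s
  cases h₅
  rfl

theorem Represents.run_inc (h : Represents n k T s) (hk : k < n) :
    ∃ s', (game r).Run (List.replicate (max r.terrascapeTurns 1)
      (counterOrder (.build .terrascape)) ++ [counterOrder (.move .east)]) s s' ∧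
      Represents n (k + 1) T s' := by
  refine ⟨_, (turn_counterOrder_build r (by simp [h.counter]) (h.owned ▸ mem_counterTiles hk)
    (h.desert ▸ mem_counterTiles hk) h.terraforming h.stateWorker).append
      (.single (turn_counterOrder r _ _)), ?_⟩
  obtain ⟨p, hp, ht⟩ := h.tape
  refine ⟨h.desert, h.owned, h.worked, h.terraforming, h.ecoscaping, hk, fun j => ?_, ?_,
    p, hp, fun x => ?_⟩
  · change (s.setImprovement _ _).improvementAt _ = _
    rw [State.improvementAt_setImprovement, h.counter]
    rcases lt_trichotomy j k with hj | rfl | hj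
    · simp [hj, hj.ne, hj.trans (Nat.lt_succ_self k)]
    · simp
    · simp [hj.ne', hj.not_gt, show ¬ j < k + 1 by omega]
  · change Worker.move s.stateWorker _ = _
    simp [h.stateWorker, Worker.move, HexDir.vec]
  · change (s.setImprovement _ _).improvementAt _ = _
    rw [State.improvementAt_setImprovement, ht]
    simp

theorem Represents.run_dec (h : Represents n (k + 1) T s) :
    ∃ s', (game r).Run ([counterOrder (.move .west)] ++ [counterOrder .remove]) s s' ∧
      Represents n k T s' := by
  have hw : (((k + 1 : ℕ) : ℤ), (1 : ℤ)) + HexDir.west.vec = ((k : ℤ), (1 : ℤ)) := by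
    simp [HexDir.vec]
  have h₁ : turn r s (counterOrder (.move .west)) =
      some { s with stateWorker := ⟨(k, 1), none⟩ } := by
    rw [turn_counterOrder, h.stateWorker]
    simp only [workerTurn, Worker.move, hw, Option.map_some]
  refine ⟨_, .append (.single h₁) (.single (turn_counterOrder_remove r (h := (k, 1)) ?_ rfl)), ?_⟩
  · change s.improvementAt _ ≠ _
    simp [h.counter]
  obtain ⟨p, hp, ht⟩ := h.tape
  refine ⟨h.desert, h.owned, h.worked, h.terraforming, h.ecoscaping, (Nat.le_succ k).trans h.le,
    fun j => ?_, rfl, p, hp, fun x => ?_⟩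
  · change (s.setImprovement _ _).improvementAt _ = _
    rw [State.improvementAt_setImprovement, h.counter]
    rcases lt_trichotomy j k with hj | rfl | hj
    · simp [hj, hj.ne, hj.trans (Nat.lt_succ_self k)]
    · simp
    · simp [hj.ne', hj.not_gt, show ¬ j < k + 1 by omega]
  · change (s.setImprovement _ _).improvementAt _ = _
    rw [State.improvementAt_setImprovement, ht]
    simp

theorem Represents.run_move (h : Represents n k T s) (d : Turing.Dir) :
    ∃ s', (game r).Run [tapeOrder (.move d.toHexDir)] s s' ∧ Represents n k (T.move d) s' := by
  refine ⟨_, .single (turn_tapeOrder r s (.move d.toHexDir)), ?_⟩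
  obtain ⟨p, hp, ht⟩ := h.tape
  refine ⟨h.desert, h.owned, h.worked, h.terraforming, h.ecoscaping, h.le, h.counter,
    h.stateWorker, p + d.toHexDir.vec.1, ?_, fun x => (ht x).trans ?_⟩
  · change Worker.move s.tapeWorker _ = _
    cases d <;> simp [hp, Worker.move, HexDir.vec, Turing.Dir.toHexDir]
  · cases d
    · rw [Turing.Tape.move_left_nth]
      simp only [Turing.Dir.toHexDir, HexDir.vec]
      congr 2
      ring
    · rw [Turing.Tape.move_right_nth]
      simp only [Turing.Dir.toHexDir, HexDir.vec]
      congr 2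
      ring

theorem Represents.run_write (h : Represents n k T s) (a : Bool) (ha : T.head ≠ a) :
    ∃ s', (game r).Run (cond a (List.replicate (max r.roadTurns 1) (tapeOrder (.build .road)))
      [tapeOrder .remove]) s s' ∧ Represents n k (T.write a) s' := by
  obtain ⟨p, hp, ht⟩ := h.tape
  have hT : s.improvementAt (p, 0) = symbol T.head := by simp [ht]
  have key : Represents n k (T.write a) (s.setImprovement (p, 0) (symbol a)) := by
    refine ⟨h.desert, h.owned, h.worked, h.terraforming, h.ecoscaping, h.le, fun j => ?_,
      h.stateWorker, p, hp, fun x => ?_⟩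
    · rw [State.improvementAt_setImprovement, h.counter]
      simp
    · rw [State.improvementAt_setImprovement, ht, Turing.Tape.write_nth]
      by_cases hx : x = p
      · simp [hx]
      · simp [hx, sub_eq_zero]
  refine ⟨_, ?_, key⟩
  cases a
  · have hh : T.head = true := by simpa using ha
    exact .single (turn_tapeOrder_remove r (by rw [hT, hh]; decide) hp)
  · have hh : T.head = false := by simpa using ha
    exact turn_tapeOrder_build r (by rw [hT, hh]; rfl) hp

/-- Terrascapes and Roads as a counter and a tape. -/
def tapeInterface (n : ℕ) : (game r).TapeInterface n where
  R := Represents n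
  obs k := ((r.terrascapeCulture + 1) * k.1, symbol k.2)
  obs_injective := by
    rintro ⟨k, b⟩ ⟨k', b'⟩ h
    simp only [Prod.mk.injEq] at h
    refine Prod.ext (Nat.eq_of_mul_eq_mul_left (Nat.succ_pos _) h.1) ?_
    cases b <;> cases b' <;> simp [symbol] at h ⊢
  inc := _
  dec := _
  move d := _
  write a := _
  observe_eq := fun h => h.observe_eq r
  run_inc h hk := h.run_inc r hk
  run_dec h := h.run_dec r
  run_move d h := h.run_move r d
  run_write a h ha := h.run_write r a ha

/-- The state in which the counter is `0` and the word `l` is on the tape. -/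
def initialState (n : ℕ) (l : List Bool) : State where
  desert := counterTiles n
  owned := counterTiles n
  worked := counterTiles n
  terraforming := true
  ecoscaping := true
  improved := (List.range l.length).map fun i : ℕ => (((i : ℤ), (0 : ℤ)), symbol (l.getI i))
  stateWorker := ⟨(0, 1), none⟩
  tapeWorker := ⟨(0, 0), none⟩
  rover := (0, 0)

theorem improvementAt_initialState_natCast (n : ℕ) (l : List Bool) (i : ℕ) :
    (initialState n l).improvementAt (i, 0) = symbol (l.getI i) := by
  have := List.lookup_map_range (fun i : ℕ => ((i : ℤ), (0 : ℤ)))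
    (fun i j h => by simpa using h) (fun i => symbol (l.getI i)) l.length i
  simp only [State.improvementAt, initialState, this]
  split_ifs with hi
  · rfl
  · rw [List.getI_eq_default _ (not_lt.1 hi)]
    rfl

theorem improvementAt_initialState_of_ne (n : ℕ) (l : List Bool) (h : Hex)
    (hh : ∀ i : ℕ, ((i : ℤ), (0 : ℤ)) ≠ h) : (initialState n l).improvementAt h = .unimproved := by
  simp only [State.improvementAt, initialState]
  rw [List.lookup_map_range_of_ne (fun i : ℕ => ((i : ℤ), (0 : ℤ))) _ _ _ hh]
  rfl

theorem represents_initialState (n : ℕ) (l : List Bool) :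
    Represents n 0 (Turing.Tape.mk₁ l) (initialState n l) := by
  refine ⟨rfl, rfl, rfl, rfl, rfl, Nat.zero_le n, fun j => ?_, rfl, 0, rfl, fun x => ?_⟩
  · rw [improvementAt_initialState_of_ne _ _ _ (by simp)]
    simp
  · rw [sub_zero]
    rcases lt_or_ge x 0 with hx | hx
    · rw [Turing.Tape.mk₁_nth_of_neg l hx, improvementAt_initialState_of_ne]
      · rfl
      · intro i hi
        simp only [Prod.mk.injEq, and_true] at hi
        omega
    · obtain ⟨i, rfl⟩ := Int.eq_ofNat_of_zero_le hx
      rw [improvementAt_initialState_natCast]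
      exact congrArg symbol (Turing.Tape.mk₁_nth_natCast l i).symm

theorem valid_initialState (n : ℕ) (l : List Bool) : Valid (initialState n l) := by
  have key : ∀ h i, (initialState n l).improvementAt h = i → i = .unimproved ∨ i = .road := by
    rintro h _ rfl
    by_cases hh : ∃ i : ℕ, ((i : ℤ), (0 : ℤ)) = h
    · obtain ⟨i, rfl⟩ := hh
      rw [improvementAt_initialState_natCast]
      cases l.getI i <;> simp [symbol]
    · rw [improvementAt_initialState_of_ne _ _ _ (by simpa using hh)]
      simp
  refine ⟨counterTiles_nodup n, fun h hh => hh, fun h hh => ?_, fun h hh => ?_, rfl, rfl⟩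
  · simpa using key h _ hh
  · simpa using key h _ hh

theorem computable_initialState (n : ℕ) : Computable (initialState n) := by
  have h₁ : Primrec fun l : List Bool =>
      (List.range l.length).map fun i : ℕ => (((i : ℤ), (0 : ℤ)), symbol (l.getI i)) := by
    refine Primrec.list_map (Primrec.list_range.comp Primrec.list_length) (Primrec.pair
      (Primrec.pair (Primrec.int_natCast.comp Primrec.snd) (Primrec.const 0))
      ((Primrec.dom_finite symbol).comp (Primrec.list_getI.comp Primrec.fst Primrec.snd)))
  have h₂ : Primrec fun l : List Bool => State.equiv (initialState n l) :=
    (Primrec.const _).pair ((Primrec.const _).pair ((Primrec.const _).pair ((Primrec.const _).pair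
      ((Primrec.const _).pair (h₁.pair (Primrec.const
        ((⟨(0, 1), none⟩ : Worker Project), (⟨(0, 0), none⟩ : Worker Project),
        ((0, 0) : Hex))))))))
  exact ((Primrec.of_equiv_symm (e := State.equiv)).comp h₂).to_comp

theorem simulatesUniversal : ∃ T : CommandTable (ℕ × Improvement) Order,
    (game r).SimulatesUniversal T ∧ (game r).UndecidableUnder T :=
  CivGame.exists_simulatesUniversal_of_tapeInterface fun n => ⟨tapeInterface r n, initialState n,
    computable_initialState n, fun l => ⟨valid_initialState n l, represents_initialState n l⟩⟩

end CivBE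


namespace CivV

/-- The tiles on which the value of the counter is recorded. -/
def counterTiles (n : ℕ) : List Hex := (List.range n).map fun j : ℕ => ((j : ℤ), (1 : ℤ))

theorem State.improvementAt_setImprovement (s : State) (h h' : Hex) (i : Improvement) :
    (s.setImprovement h i).improvementAt h' = if h' = h then i else s.improvementAt h' := by
  by_cases e : h' = h
  · subst e
    simp [improvementAt, setImprovement]
  · simp [improvementAt, setImprovement, List.lookup_cons, beq_eq_false_iff_ne.2 e, e]

/-- The symbols on the tape. -/
def symbol : Bool → Improvement
  | false => .unimproved
  | true => .road

open Turing in
/-- The state `s` records the number `k` by Railroads and the tape `T` by Roads. -/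
structure Represents (n k : ℕ) (T : Tape Bool) (s : State) : Prop where
  owned : s.owned = counterTiles n
  engineering : s.engineering = true
  le : k ≤ n
  counter : ∀ j : ℕ, s.improvementAt (j, 1) = if j < k then .railroad else .unimproved
  stateWorker : s.stateWorker = ⟨(k, 1), none⟩
  tape : ∃ p : ℤ, s.tapeWorker = ⟨(p, 0), none⟩ ∧
    ∀ x, s.improvementAt (x, 0) = symbol (T.nth (x - p))

theorem counterTiles_nodup (n : ℕ) : (counterTiles n).Nodup :=
  List.nodup_range.map fun i j h => by simpa using h

variable {n k : ℕ} {T : Turing.Tape Bool} {s : State} (r : Rules)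

theorem Represents.observe_eq (h : Represents n k T s) :
    observe s = (k, symbol T.head) := by
  obtain ⟨p, hp, ht⟩ := h.tape
  have h₁ : (s.owned.countP fun h => s.improvementAt h = .railroad) = k := by
    rw [h.owned, counterTiles, List.countP_map]
    have : ((fun h => decide (s.improvementAt h = .railroad)) ∘ fun j : ℕ => ((j : ℤ), (1 : ℤ))) =
        fun j => decide (j < k) := by
      funext j
      simp only [Function.comp_apply, h.counter j]
      by_cases hj : j < k <;> simp [hj]
    rw [this, List.countP_eq_length_filter]
    have hle := h.le
    obtain ⟨m, rfl⟩ := Nat.exists_eq_add_of_le hle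
    rw [List.range_add, List.filter_append, List.filter_eq_self.2, List.filter_eq_nil_iff.2]
    · simp
    · simp
    · simp
  simp only [observe, State.railroads, h₁, hp, ht]
  simp

/-- Orders only for the Worker on the tiles of the counter. -/
def counterOrder (o : WorkerOrder) : Order := ⟨o, .wait⟩

/-- Orders only for the Worker on the tape. -/
def tapeOrder (o : WorkerOrder) : Order := ⟨.wait, o⟩

theorem turn_counterOrder (s : State) (o : WorkerOrder) : turn r s (counterOrder o) =
    (workerTurn r s s.stateWorker o).map fun x => { x.1 with stateWorker := x.2 } := by
  simp only [turn, counterOrder]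
  cases workerTurn r s s.stateWorker o <;> rfl

theorem turn_tapeOrder (s : State) (o : WorkerOrder) : turn r s (tapeOrder o) =
    (workerTurn r s s.tapeWorker o).map fun x => { x.1 with tapeWorker := x.2 } := by
  have : turn r s (tapeOrder o) = (workerTurn r s s.tapeWorker o).bind fun x =>
    some { x.1 with tapeWorker := x.2 } := rfl
  rw [this]
  cases workerTurn r s s.tapeWorker o <;> rfl

theorem turn_counterOrder_build {s : State} {h : Hex} (h₁ : s.improvementAt h = .unimproved)
    (h₂ : s.engineering = true)
    (h₅ : s.stateWorker = ⟨h, none⟩) :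
    (game r).Run (List.replicate (max r.railroadTurns 1) (counterOrder (.build .railroad))) s
      (s.setImprovement h .railroad) := by
  have hb := Worker.foldlM_build (game r).turn (counterOrder (.build .railroad))
    (fun j => { s with stateWorker := ⟨h, j⟩ })
    { s.setImprovement h .railroad with stateWorker := ⟨h, none⟩ }
    .railroad r.railroadTurns h (fun j => by
      change turn r _ _ = _
      rw [turn_counterOrder]
      change Option.map _
        (if s.improvementAt h = .unimproved ∧ s.engineering = true then _ else none) = _
      rw [if_pos ⟨h₁, h₂⟩]
      dsimp only
      rcases (⟨h, j⟩ : Worker Project).work_eq .railroad r.railroadTurns with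
        hx | ⟨j', hx⟩ <;> rw [hx] <;> rfl)
  rw [← h₅] at hb
  exact hb

theorem turn_tapeOrder_build {s : State} {h : Hex} (h₁ : s.improvementAt h = .unimproved)
    (h₅ : s.tapeWorker = ⟨h, none⟩) :
    (game r).Run (List.replicate (max r.roadTurns 1) (tapeOrder (.build .road))) s
      (s.setImprovement h .road) := by
  have hb := Worker.foldlM_build (game r).turn (tapeOrder (.build .road))
    (fun j => { s with tapeWorker := ⟨h, j⟩ })
    { s.setImprovement h .road with tapeWorker := ⟨h, none⟩ }
    .road r.roadTurns h (fun j => by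
      change turn r _ _ = _
      rw [turn_tapeOrder]
      change Option.map _ (if s.improvementAt h = .unimproved then _ else none) = _
      rw [if_pos h₁]
      dsimp only
      rcases (⟨h, j⟩ : Worker Project).work_eq .road r.roadTurns with
        hx | ⟨j', hx⟩ <;> rw [hx] <;> rfl)
  rw [← h₅] at hb
  exact hb

theorem turn_tapeOrder_remove {s : State} {h : Hex} (h₁ : s.improvementAt h ≠ .unimproved)
    (h₅ : s.tapeWorker = ⟨h, none⟩) :
    turn r s (tapeOrder .remove) = some (s.setImprovement h .unimproved) := by
  have h₆ : s.improvementAt s.tapeWorker.pos ≠ .unimproved := by rwa [h₅]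
  rw [turn_tapeOrder]
  change Option.map _ (if s.improvementAt s.tapeWorker.pos ≠ .unimproved then _ else none) = _
  rw [if_pos h₆]
  cases s
  cases h₅
  rfl

theorem turn_counterOrder_remove {s : State} {h : Hex} (h₁ : s.improvementAt h ≠ .unimproved)
    (h₅ : s.stateWorker = ⟨h, none⟩) :
    turn r s (counterOrder .remove) = some (s.setImprovement h .unimproved) := by
  have h₆ : s.improvementAt s.stateWorker.pos ≠ .unimproved := by rwa [h₅]
  rw [turn_counterOrder]
  change Option.map _ (if s.improvementAt s.stateWorker.pos ≠ .unimproved then _ else none) = _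
  rw [if_pos h₆]
  cases s
  cases h₅
  rfl

theorem Represents.run_inc (h : Represents n k T s) (hk : k < n) :
    ∃ s', (game r).Run (List.replicate (max r.railroadTurns 1)
      (counterOrder (.build .railroad)) ++ [counterOrder (.move .east)]) s s' ∧
      Represents n (k + 1) T s' := by
  refine ⟨_, (turn_counterOrder_build r (by simp [h.counter]) h.engineering h.stateWorker).append
      (.single (turn_counterOrder r _ _)), ?_⟩
  obtain ⟨p, hp, ht⟩ := h.tape
  refine ⟨h.owned, h.engineering, hk, fun j => ?_, ?_,
    p, hp, fun x => ?_⟩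
  · change (s.setImprovement _ _).improvementAt _ = _
    rw [State.improvementAt_setImprovement, h.counter]
    rcases lt_trichotomy j k with hj | rfl | hj
    · simp [hj, hj.ne, hj.trans (Nat.lt_succ_self k)]
    · simp
    · simp [hj.ne', hj.not_gt, show ¬ j < k + 1 by omega]
  · change Worker.move s.stateWorker _ = _
    simp [h.stateWorker, Worker.move, HexDir.vec]
  · change (s.setImprovement _ _).improvementAt _ = _
    rw [State.improvementAt_setImprovement, ht]
    simp

theorem Represents.run_dec (h : Represents n (k + 1) T s) :
    ∃ s', (game r).Run ([counterOrder (.move .west)] ++ [counterOrder .remove]) s s' ∧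
      Represents n k T s' := by
  have hw : (((k + 1 : ℕ) : ℤ), (1 : ℤ)) + HexDir.west.vec = ((k : ℤ), (1 : ℤ)) := by
    simp [HexDir.vec]
  have h₁ : turn r s (counterOrder (.move .west)) =
      some { s with stateWorker := ⟨(k, 1), none⟩ } := by
    rw [turn_counterOrder, h.stateWorker]
    simp only [workerTurn, Worker.move, hw, Option.map_some]
  refine ⟨_, .append (.single h₁) (.single (turn_counterOrder_remove r (h := (k, 1)) ?_ rfl)), ?_⟩
  · change s.improvementAt _ ≠ _
    simp [h.counter]
  obtain ⟨p, hp, ht⟩ := h.tape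
  refine ⟨h.owned, h.engineering, (Nat.le_succ k).trans h.le,
    fun j => ?_, rfl, p, hp, fun x => ?_⟩
  · change (s.setImprovement _ _).improvementAt _ = _
    rw [State.improvementAt_setImprovement, h.counter]
    rcases lt_trichotomy j k with hj | rfl | hj
    · simp [hj, hj.ne, hj.trans (Nat.lt_succ_self k)]
    · simp
    · simp [hj.ne', hj.not_gt, show ¬ j < k + 1 by omega]
  · change (s.setImprovement _ _).improvementAt _ = _
    rw [State.improvementAt_setImprovement, ht]
    simp

theorem Represents.run_move (h : Represents n k T s) (d : Turing.Dir) :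
    ∃ s', (game r).Run [tapeOrder (.move d.toHexDir)] s s' ∧ Represents n k (T.move d) s' := by
  refine ⟨_, .single (turn_tapeOrder r s (.move d.toHexDir)), ?_⟩
  obtain ⟨p, hp, ht⟩ := h.tape
  refine ⟨h.owned, h.engineering, h.le, h.counter,
    h.stateWorker, p + d.toHexDir.vec.1, ?_, fun x => (ht x).trans ?_⟩
  · change Worker.move s.tapeWorker _ = _
    cases d <;> simp [hp, Worker.move, HexDir.vec, Turing.Dir.toHexDir]
  · cases d
    · rw [Turing.Tape.move_left_nth]
      simp only [Turing.Dir.toHexDir, HexDir.vec]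
      congr 2
      ring
    · rw [Turing.Tape.move_right_nth]
      simp only [Turing.Dir.toHexDir, HexDir.vec]
      congr 2
      ring

theorem Represents.run_write (h : Represents n k T s) (a : Bool) (ha : T.head ≠ a) :
    ∃ s', (game r).Run (cond a (List.replicate (max r.roadTurns 1) (tapeOrder (.build .road)))
      [tapeOrder .remove]) s s' ∧ Represents n k (T.write a) s' := by
  obtain ⟨p, hp, ht⟩ := h.tape
  have hT : s.improvementAt (p, 0) = symbol T.head := by simp [ht]
  have key : Represents n k (T.write a) (s.setImprovement (p, 0) (symbol a)) := by
    refine ⟨h.owned, h.engineering, h.le, fun j => ?_,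
      h.stateWorker, p, hp, fun x => ?_⟩
    · rw [State.improvementAt_setImprovement, h.counter]
      simp
    · rw [State.improvementAt_setImprovement, ht, Turing.Tape.write_nth]
      by_cases hx : x = p
      · simp [hx]
      · simp [hx, sub_eq_zero]
  refine ⟨_, ?_, key⟩
  cases a
  · have hh : T.head = true := by simpa using ha
    exact .single (turn_tapeOrder_remove r (by rw [hT, hh]; decide) hp)
  · have hh : T.head = false := by simpa using ha
    exact turn_tapeOrder_build r (by rw [hT, hh]; rfl) hp

/-- Railroads and Roads as a counter and a tape. -/
def tapeInterface (n : ℕ) : (game r).TapeInterface n where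
  R := Represents n
  obs k := (k.1, symbol k.2)
  obs_injective := by
    rintro ⟨k, b⟩ ⟨k', b'⟩ h
    simp only [Prod.mk.injEq] at h
    refine Prod.ext h.1 ?_
    cases b <;> cases b' <;> simp [symbol] at h ⊢
  inc := _
  dec := _
  move d := _
  write a := _
  observe_eq := fun h => h.observe_eq
  run_inc h hk := h.run_inc r hk
  run_dec h := h.run_dec r
  run_move d h := h.run_move r d
  run_write a h ha := h.run_write r a ha

/-- The state in which the counter is `0` and the word `l` is on the tape. -/
def initialState (n : ℕ) (l : List Bool) : State where
  owned := counterTiles n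
  engineering := true
  improved := (List.range l.length).map fun i : ℕ => (((i : ℤ), (0 : ℤ)), symbol (l.getI i))
  stateWorker := ⟨(0, 1), none⟩
  tapeWorker := ⟨(0, 0), none⟩

theorem improvementAt_initialState_natCast (n : ℕ) (l : List Bool) (i : ℕ) :
    (initialState n l).improvementAt (i, 0) = symbol (l.getI i) := by
  have := List.lookup_map_range (fun i : ℕ => ((i : ℤ), (0 : ℤ)))
    (fun i j h => by simpa using h) (fun i => symbol (l.getI i)) l.length i
  simp only [State.improvementAt, initialState, this]
  split_ifs with hi
  · rfl
  · rw [List.getI_eq_default _ (not_lt.1 hi)]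
    rfl

theorem improvementAt_initialState_of_ne (n : ℕ) (l : List Bool) (h : Hex)
    (hh : ∀ i : ℕ, ((i : ℤ), (0 : ℤ)) ≠ h) : (initialState n l).improvementAt h = .unimproved := by
  simp only [State.improvementAt, initialState]
  rw [List.lookup_map_range_of_ne (fun i : ℕ => ((i : ℤ), (0 : ℤ))) _ _ _ hh]
  rfl

theorem represents_initialState (n : ℕ) (l : List Bool) :
    Represents n 0 (Turing.Tape.mk₁ l) (initialState n l) := by
  refine ⟨rfl, rfl, Nat.zero_le n, fun j => ?_, rfl, 0, rfl, fun x => ?_⟩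
  · rw [improvementAt_initialState_of_ne _ _ _ (by simp)]
    simp
  · rw [sub_zero]
    rcases lt_or_ge x 0 with hx | hx
    · rw [Turing.Tape.mk₁_nth_of_neg l hx, improvementAt_initialState_of_ne]
      · rfl
      · intro i hi
        simp only [Prod.mk.injEq, and_true] at hi
        omega
    · obtain ⟨i, rfl⟩ := Int.eq_ofNat_of_zero_le hx
      rw [improvementAt_initialState_natCast]
      exact congrArg symbol (Turing.Tape.mk₁_nth_natCast l i).symm

theorem valid_initialState (n : ℕ) (l : List Bool) : Valid (initialState n l) :=
  ⟨counterTiles_nodup n, rfl, rfl⟩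

theorem computable_initialState (n : ℕ) : Computable (initialState n) := by
  have h₁ : Primrec fun l : List Bool =>
      (List.range l.length).map fun i : ℕ => (((i : ℤ), (0 : ℤ)), symbol (l.getI i)) := by
    refine Primrec.list_map (Primrec.list_range.comp Primrec.list_length) (Primrec.pair
      (Primrec.pair (Primrec.int_natCast.comp Primrec.snd) (Primrec.const 0))
      ((Primrec.dom_finite symbol).comp (Primrec.list_getI.comp Primrec.fst Primrec.snd)))
  have h₂ : Primrec fun l : List Bool => State.equiv (initialState n l) :=
    (Primrec.const _).pair ((Primrec.const _).pair (h₁.pair (Primrec.const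
      ((⟨(0, 1), none⟩ : Worker Project), (⟨(0, 0), none⟩ : Worker Project)))))
  exact ((Primrec.of_equiv_symm (e := State.equiv)).comp h₂).to_comp

theorem simulatesUniversal : ∃ T : CommandTable (ℕ × Improvement) Order,
    (game r).SimulatesUniversal T ∧ (game r).UndecidableUnder T :=
  CivGame.exists_simulatesUniversal_of_tapeInterface fun n => ⟨tapeInterface r n, initialState n,
    computable_initialState n, fun l => ⟨valid_initialState n l, represents_initialState n l⟩⟩

end CivV


namespace CivVI

/-- The two tiles next to a City on which its Citizen may work, as offsets from the City. -/
def spot (b : Bool) : Hex := cond b (1, -1) (0, -1)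

/-- The tiles of a City: its own tile and the adjacent ones. -/
def cityTiles (p : Hex) : List Hex := p :: Hex.neighbors p

/-- A City that owns its own tile and the adjacent ones and whose growth is capped. -/
def mkCity (p : Hex) (population : ℕ) (worked : List Hex) (food cap progress : ℕ) : City where
  center := p
  tiles := cityTiles p
  population := population
  worked := worked
  food := food
  cap := some cap
  settlerProgress := progress

/-- The tiles on which Cities may stand. -/
def IsSite (p : Hex) : Prop := (4 : ℤ) ∣ p.1 ∧ (4 : ℤ) ∣ p.2

/-- `f` assigns to each tile a City that stands on it and owns the adjacent tiles. -/
def Layout (f : Hex → City) : Prop := ∀ p, (f p).center = p ∧ (f p).tiles = cityTiles p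

/-- The state with Cities `f p` on the tiles `p` of the list `I`. -/
def layoutState (I : List Hex) (f : Hex → City) (mon : List Hex) (w : Hex) (st : Option Hex) :
    State :=
  ⟨I.map f, mon, [], w, st⟩

theorem natAbs_le_of_mem_cityTiles {h p : Hex} (hh : h ∈ cityTiles p) :
    (h.1 - p.1).natAbs ≤ 1 ∧ (h.2 - p.2).natAbs ≤ 1 := by
  obtain ⟨x, y⟩ := p
  simp only [cityTiles, Hex.neighbors, HexDir.vec, List.map_cons, List.map_nil, List.mem_cons,
    List.not_mem_nil, or_false, Prod.mk_add_mk] at hh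
  rcases hh with rfl | rfl | rfl | rfl | rfl | rfl | rfl <;> constructor <;> dsimp only <;> omega

theorem self_mem_cityTiles (p : Hex) : p ∈ cityTiles p := List.mem_cons_self

theorem spot_mem_cityTiles (p : Hex) (b : Bool) : p + spot b ∈ cityTiles p := by
  cases b <;> simp [spot, cityTiles, Hex.neighbors, HexDir.vec]

theorem add_spot_ne (p : Hex) (b : Bool) : p + spot b ≠ p := by
  cases b <;> simp [spot]

theorem add_spot_inj {p : Hex} {b b' : Bool} : p + spot b = p + spot b' ↔ b = b' := by
  cases b <;> cases b' <;> simp [spot]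

theorem IsSite.eq_of_mem {p q h : Hex} (hp : IsSite p) (hq : IsSite q) (h₁ : h ∈ cityTiles p)
    (h₂ : h ∈ cityTiles q) : p = q := by
  have h₁ := natAbs_le_of_mem_cityTiles h₁
  have h₂ := natAbs_le_of_mem_cityTiles h₂
  obtain ⟨⟨a, ha⟩, b, hb⟩ := hp
  obtain ⟨⟨c, hc⟩, d, hd⟩ := hq
  exact Prod.ext (by omega) (by omega)

theorem IsSite.four_le_dist {p q : Hex} (hp : IsSite p) (hq : IsSite q) (h : p ≠ q) :
    4 ≤ Hex.dist p q := by
  obtain ⟨⟨a, ha⟩, b, hb⟩ := hp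
  obtain ⟨⟨c, hc⟩, d, hd⟩ := hq
  unfold Hex.dist
  by_cases h₁ : p.1 = q.1
  · have h₂ : p.2 ≠ q.2 := fun h₂ => h (Prod.ext h₁ h₂)
    omega
  · omega

section layoutState

variable {I : List Hex} {f : Hex → City} {mon : List Hex} {w : Hex} {st : Option Hex} {p h : Hex}

theorem cityAt_layoutState (hf : Layout f) (hI : ∀ p ∈ I, IsSite p) (hp : p ∈ I)
    (hh : h ∈ cityTiles p) : (layoutState I f mon w st).cityAt h = some (f p) := by
  simp only [layoutState, State.cityAt]
  induction I with
  | nil => simp at hp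
  | cons q I ih =>
    rw [List.map_cons, List.find?_cons, (hf q).2]
    by_cases hq : h ∈ cityTiles q
    · rw [(hI q (by simp)).eq_of_mem (hI p hp) hq hh]
      simp [hh]
    · have hpq : p ≠ q := fun e => hq (e ▸ hh)
      simp only [hq, decide_false]
      exact ih (fun p hp => hI p (by simp [hp])) (by simpa [hpq] using hp)

theorem cityAt_layoutState_eq_none (hf : Layout f) (hI : ∀ p ∈ I, h ∉ cityTiles p) :
    (layoutState I f mon w st).cityAt h = none := by
  simp only [layoutState, State.cityAt, List.find?_eq_none, List.mem_map]
  rintro _ ⟨q, hq, rfl⟩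
  simpa [(hf q).2] using hI q hq

theorem setCity_layoutState (hf : Layout f) (c : City) : (layoutState I f mon w st).setCity c =
    layoutState I (Function.update f c.center c) mon w st := by
  simp only [layoutState, State.setCity, List.map_map]
  congr 1
  refine List.map_congr_left fun q _ => ?_
  by_cases h : q = c.center
  · simp [h, (hf _).1]
  · simp [h, (hf _).1]

theorem Layout.update (hf : Layout f) {c : City} (hp : c.center = p) (hc : c.tiles = cityTiles p) :
    Layout (Function.update f p c) := by
  intro q
  by_cases h : q = p
  · subst h
    simp [hp, hc]
  · simpa [h] using hf q

theorem reassign_layoutState (hf : Layout f) (hI : ∀ p ∈ I, IsSite p) (hp : p ∈ I) {b : Bool}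
    (hw : (f p).worked = [p + spot b]) :
    reassign (layoutState I f mon w st) (p + spot b) (p + spot !b) = some (layoutState I
      (Function.update f p { f p with worked := [p + spot !b] }) mon w st) := by
  have h₁ : p + spot (!b) ∈ (f p).tiles := (hf p).2 ▸ spot_mem_cityTiles p _
  have h₂ : p + spot (!b) ≠ p + spot b := add_spot_inj.not.2 (by cases b <;> simp)
  have h₃ : p + spot (!b) ≠ (f p).center := (hf p).1.symm ▸ add_spot_ne p _
  simp only [reassign, cityAt_layoutState hf hI hp (spot_mem_cityTiles p b), hw,
    Option.bind_eq_bind, Option.bind_some]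
  rw [if_pos ⟨by simp, h₁, by simpa using h₂, h₃⟩, setCity_layoutState hf]
  simp [(hf p).1]

theorem setCap_layoutState (hf : Layout f) (hI : ∀ p ∈ I, IsSite p) (hp : p ∈ I)
    (hh : h ∈ cityTiles p) (k : ℕ) : setCap (layoutState I f mon w st) h k =
      some (layoutState I (Function.update f p { f p with cap := some k }) mon w st) := by
  simp only [setCap, cityAt_layoutState hf hI hp hh, Option.bind_eq_bind, Option.bind_some,
    setCity_layoutState hf, (hf p).1]
  rfl

theorem train_layoutState (r : Rules) (hf : Layout f) (hI : ∀ p ∈ I, IsSite p) (hp : p ∈ I)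
    {b : Bool} {fd cap pr : ℕ} (hc : f p = mkCity p 2 [p + spot b] fd cap pr)
    (hh : h ∈ cityTiles p) :
    CivVI.train r (layoutState I f mon w none) h (p + spot b) =
      some (if 30 * I.length + 50 ≤ pr + r.production then
        layoutState I (Function.update f p (mkCity p 1 [] fd cap 0)) mon w (some p)
      else
        layoutState I (Function.update f p (mkCity p 2 [p + spot b] fd cap (pr + r.production)))
          mon w none) := by
  have h₁ : (layoutState I f mon w none).settlerCost = 30 * I.length + 50 := by
    simp [State.settlerCost, layoutState]
  have h₂ : (layoutState I f mon w none).settler = none := rfl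
  simp only [CivVI.train, cityAt_layoutState hf hI hp hh, hc, h₁, h₂,
    Option.bind_eq_bind, Option.bind_some, mkCity, setCity_layoutState hf]
  rw [if_pos ⟨le_rfl, by simp, trivial⟩]
  split_ifs
  · simp [layoutState]
  · rfl

/-- A new Citizen of a City on the grassland strip works north-east of the City. -/
theorem placeCitizen_eq (s : State) (c : City) {x : ℤ} (hc : c.center = (x, 0))
    (ht : c.tiles = cityTiles (x, 0)) (hw : c.worked = []) (hfarm : s.farms = [])
    (hmon : ∀ h ∈ cityTiles (x, 0), h ∉ s.monasteries) :
    s.placeCitizen c = { c with worked := [((x, 0) : Hex) + spot true] } := by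
  have hv : ∀ h ∈ cityTiles (x, 0), s.tileFood h + s.tileFaith h = if h.2 = 0 then 2 else 3 := by
    intro h hh
    by_cases h₀ : h.2 = 0 <;>
      simp [State.tileFood, State.tileFaith, hfarm, hmon h hh, terrainFood, IsGrassland, h₀]
  have hfil : (c.tiles.filter fun h => h ≠ c.center ∧ h ∉ c.worked) = Hex.neighbors (x, 0) := by
    rw [ht, hc, hw]
    simp [cityTiles, Hex.neighbors, HexDir.vec]
  have harg : (Hex.neighbors (x, 0)).argmax (fun h => s.tileFood h + s.tileFaith h) =
      some ((x, 0) + spot true) := by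
    simp [cityTiles, Hex.neighbors, HexDir.vec] at hv
    obtain ⟨-, h1, h2, h3, h4, h5, h6⟩ := hv
    simp [Hex.neighbors, HexDir.vec, List.argmax, List.argAux, h1, h2, h3, h4, h5, h6, spot]
  unfold State.placeCitizen
  rw [hfil, harg, hw]

theorem found_layoutState (hf : Layout f) (hI : ∀ p ∈ I, IsSite p) {x : ℤ} (hx : IsSite (x, 0))
    (hxI : (x, 0) ∉ I) (hmon : ∀ h ∈ cityTiles (x, 0), h ∉ mon) :
    settlerTurn (layoutState I f mon w (some (x, 0))) .found =
      some (layoutState ((x, 0) :: I) (Function.update f (x, 0)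
        { mkCity (x, 0) 2 [((x, 0) : Hex) + spot true] 0 0 0 with cap := none }) mon w none) := by
  have hnone : ∀ h ∈ cityTiles (x, 0),
      (layoutState I f mon w (some (x, 0))).cityAt h = none := fun h hh =>
    cityAt_layoutState_eq_none hf fun p hp hh' => hxI (hx.eq_of_mem (hI p hp) hh hh' ▸ hp)
  have hdist : ∀ c ∈ (layoutState I f mon w (some (x, 0))).cities,
      4 ≤ Hex.dist (x, 0) c.center := by
    intro c hc
    obtain ⟨q, hq, rfl⟩ := List.mem_map.1 hc
    rw [(hf q).1]
    exact hx.four_le_dist (hI q hq) fun e => hxI (by rwa [e])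
  have htiles : ((Hex.neighbors (x, 0)).filter fun h =>
      ((layoutState I f mon w (some (x, 0))).cityAt h).isNone) = Hex.neighbors (x, 0) :=
    List.filter_eq_self.2 fun h hh => by rw [hnone h (List.mem_cons_of_mem _ hh)]; rfl
  have hmap : I.map (Function.update f (x, 0)
      { mkCity (x, 0) 2 [((x, 0) : Hex) + spot true] 0 0 0 with cap := none }) = I.map f :=
    List.map_congr_left fun q hq => Function.update_of_ne (fun e => hxI (by rwa [← e])) _ _
  have hset : (layoutState I f mon w (some (x, 0))).settler = some (x, 0) := rfl
  simp only [settlerTurn, hset, Option.bind_eq_bind, Option.bind_some]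
  rw [if_pos ⟨hnone _ (self_mem_cityTiles _), hdist⟩, htiles,
    placeCitizen_eq (x := x) _ _ rfl rfl rfl rfl hmon]
  simp only [layoutState, List.map_cons, hmap, Function.update_self]
  rfl

/-- The growth of the City is stopped by its cap. -/
def City.Capped (c : City) : Prop := ∃ k ∈ c.cap, k ≤ c.population

theorem mkCity_capped {k cap fd pr : ℕ} {l : List Hex} (h : cap ≤ k) :
    (mkCity p k l fd cap pr).Capped := ⟨cap, rfl, h⟩

theorem endTurn_layoutState (r : Rules) (hI : ∀ q ∈ I, (f q).Capped) :
    { layoutState I f mon w st with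
      cities := (layoutState I f mon w st).cities.map ((layoutState I f mon w st).grow r) } =
    layoutState I f mon w st := by
  simp only [layoutState, List.map_map]
  congr 1
  refine List.map_congr_left fun q hq => ?_
  exact if_pos (hI q hq)

theorem endTurn_layoutState_of_ne (r : Rules) (hI : ∀ q ∈ I, q ≠ p → (f q).Capped) :
    { layoutState I f mon w st with
      cities := (layoutState I f mon w st).cities.map ((layoutState I f mon w st).grow r) } =
    layoutState I (Function.update f p ((layoutState I f mon w st).grow r (f p))) mon w st := by
  simp only [layoutState, List.map_map]
  congr 1
  refine List.map_congr_left fun q hq => ?_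
  by_cases h : q = p
  · simp [h]
  · simp only [Function.comp_apply, Function.update_of_ne h]
    exact if_pos (hI q hq h)

theorem grow_mkCity_one (r : Rules) {x : ℤ} (hmon : ∀ h ∈ cityTiles (x, 0), h ∉ mon) (fd pr : ℕ) :
    (layoutState I f mon w st).grow r (mkCity (x, 0) 1 [] fd 2 pr) =
      if r.growthFood 1 ≤ fd + 2 then
        mkCity (x, 0) 2 [((x, 0) : Hex) + spot true] (fd + 2 - r.growthFood 1) 2 pr
      else mkCity (x, 0) 1 [] (fd + 2) 2 pr := by
  have h₁ : (layoutState I f mon w st).cityFood (mkCity (x, 0) 1 [] fd 2 pr) = 4 := by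
    simp [State.cityFood, mkCity, terrainFood, IsGrassland]
  unfold State.grow
  rw [if_neg (by simp [mkCity]), h₁]
  dsimp only
  have h₂ : (mkCity (x, 0) 1 [] fd 2 pr).food + (4 - 2 * (mkCity (x, 0) 1 [] fd 2 pr).population) =
      fd + 2 := rfl
  have h₃ : (mkCity (x, 0) 1 [] fd 2 pr).population = 1 := rfl
  rw [h₂, h₃]
  split_ifs
  · rw [placeCitizen_eq (x := x) _ _ rfl rfl rfl rfl hmon]
    rfl
  · rfl

end layoutState

end CivVI


namespace CivVI

/-- The tiles of the Cities that record the value of the counter. -/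
def counterSite (j : ℕ) : Hex := (4 * j, 8)

/-- The tiles of the Cities that record the tape. -/
def tapeSite (x : ℤ) : Hex := (4 * x, 0)

/-- The tiles with a Monastery. -/
def monasteries (n : ℕ) : List Hex := (List.range n).map fun j => counterSite j + spot true

theorem isSite_counterSite (j : ℕ) : IsSite (counterSite j) := ⟨⟨j, rfl⟩, 2, rfl⟩

theorem isSite_tapeSite (x : ℤ) : IsSite (tapeSite x) := ⟨⟨x, rfl⟩, 0, rfl⟩

theorem tapeSite_inj {x y : ℤ} : tapeSite x = tapeSite y ↔ x = y := by
  simp [tapeSite]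

theorem counterSite_inj {i j : ℕ} : counterSite i = counterSite j ↔ i = j := by
  simp [counterSite]

theorem counterSite_ne_tapeSite (j : ℕ) (x : ℤ) : counterSite j ≠ tapeSite x := by
  simp [counterSite, tapeSite]

theorem notMem_monasteries {n : ℕ} {x : ℤ} {h : Hex} (hh : h ∈ cityTiles (tapeSite x)) :
    h ∉ monasteries n := by
  intro h'
  obtain ⟨j, -, rfl⟩ := List.mem_map.1 h'
  have := (natAbs_le_of_mem_cityTiles hh).2
  simp [counterSite, tapeSite, spot] at this

/-- The list of all Cities. -/
def sites (n : ℕ) (J : List Hex) : List Hex := J ++ (List.range n).map counterSite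

/-- The state with the Cities of the tape on the tiles in `J`. -/
def machineState (n : ℕ) (J : List Hex) (f : Hex → City) (w : Hex) (st : Option Hex) : State :=
  layoutState (sites n J) f (monasteries n) w st

/-- The City `f p` for `p` on the tape in a state of rest: its one free Citizen shows the symbol. -/
def cell (x : ℤ) (b : Bool) (fd pr : ℕ) : City :=
  mkCity (tapeSite x) 2 [tapeSite x + spot b] fd 2 pr

/-- The Cities record the value `k` of the counter, and the symbols `g` of the tape except possibly
at position `y`, where the City is `c`. -/
structure Rep (n k : ℕ) (J : List Hex) (f : Hex → City) (g : ℤ → Bool) (y : ℤ) (c : City) :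
    Prop where
  layout : Layout f
  sites : ∀ p ∈ J, ∃ x, p = tapeSite x
  le : k ≤ n
  counter : ∀ j < n, f (counterSite j) =
    mkCity (counterSite j) 2 [counterSite j + spot (decide (j < k))] 0 2 0
  mem : tapeSite y ∈ J
  city : f (tapeSite y) = c
  cells : ∀ x ≠ y, tapeSite x ∈ J → ∃ fd pr, f (tapeSite x) = cell x (g x) fd pr
  blank : ∀ x, tapeSite x ∉ J → g x = false

namespace Rep

variable {n k : ℕ} {J : List Hex} {f : Hex → City} {g : ℤ → Bool} {y : ℤ} {c : City} {w : Hex}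
  {st : Option Hex}

theorem isSite (h : Rep n k J f g y c) : ∀ p ∈ CivVI.sites n J, IsSite p := by
  intro p hp
  rcases List.mem_append.1 hp with hp | hp
  · obtain ⟨x, rfl⟩ := h.sites p hp
    exact isSite_tapeSite x
  · obtain ⟨j, -, rfl⟩ := List.mem_map.1 hp
    exact isSite_counterSite j

theorem mem_sites (h : Rep n k J f g y c) : tapeSite y ∈ CivVI.sites n J :=
  List.mem_append_left _ h.mem

theorem update (h : Rep n k J f g y c) {c' : City} (h₁ : c'.center = tapeSite y)
    (h₂ : c'.tiles = cityTiles (tapeSite y)) {g' : ℤ → Bool} (hg : ∀ x ≠ y, g' x = g x) :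
    Rep n k J (Function.update f (tapeSite y) c') g' y c' where
  layout := h.layout.update h₁ h₂
  sites := h.sites
  le := h.le
  counter j hj := by
    rw [Function.update_of_ne (counterSite_ne_tapeSite j y), h.counter j hj]
  mem := h.mem
  city := Function.update_self ..
  cells x hx hxJ := by
    rw [Function.update_of_ne (tapeSite_inj.not.2 hx), hg x hx]
    exact h.cells x hx hxJ
  blank x hx := by
    rw [hg x (fun e => hx (e ▸ h.mem))]
    exact h.blank x hx

theorem focus {fd pr : ℕ} (h : Rep n k J f g y (cell y (g y) fd pr)) {x : ℤ}
    (hx : tapeSite x ∈ J) : ∃ fd' pr', Rep n k J f g x (cell x (g x) fd' pr') := by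
  have hcell : ∀ x, tapeSite x ∈ J → ∃ fd pr, f (tapeSite x) = cell x (g x) fd pr := by
    intro x hx
    by_cases e : x = y
    · subst e
      exact ⟨fd, pr, h.city⟩
    · exact h.cells x e hx
  obtain ⟨fd', pr', e⟩ := hcell x hx
  exact ⟨fd', pr', h.layout, h.sites, h.le, h.counter, hx, e, fun x _ => hcell x, h.blank⟩

theorem forall_city (h : Rep n k J f g y c) {P : Hex → City → Prop} (hy : P (tapeSite y) c)
    (h₁ : ∀ x b fd pr, P (tapeSite x) (cell x b fd pr))
    (h₂ : ∀ j b, P (counterSite j) (mkCity (counterSite j) 2 [counterSite j + spot b] 0 2 0)) :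
    ∀ p ∈ CivVI.sites n J, P p (f p) := by
  intro p hp
  rcases List.mem_append.1 hp with hp | hp
  · obtain ⟨x, rfl⟩ := h.sites p hp
    by_cases hx : x = y
    · rw [hx, h.city]
      exact hy
    · obtain ⟨fd, pr, e⟩ := h.cells x hx hp
      rw [e]
      exact h₁ ..
  · obtain ⟨j, hj, rfl⟩ := List.mem_map.1 hp
    rw [h.counter j (List.mem_range.1 hj)]
    exact h₂ ..

theorem capped (h : Rep n k J f g y c) (hc : c.Capped) : ∀ p ∈ CivVI.sites n J, (f p).Capped :=
  h.forall_city (P := fun _ c => c.Capped) hc (fun _ _ _ _ => mkCity_capped le_rfl)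
    (fun _ _ => mkCity_capped le_rfl)

theorem capped_of_ne (h : Rep n k J f g y c) :
    ∀ p ∈ CivVI.sites n J, p ≠ tapeSite y → (f p).Capped :=
  h.forall_city (P := fun p c => p ≠ tapeSite y → c.Capped) (fun e => absurd rfl e)
    (fun _ _ _ _ _ => mkCity_capped le_rfl) (fun _ _ _ => mkCity_capped le_rfl)

theorem worked_subset (h : Rep n k J f g y c) (hc : ∀ q ∈ c.worked, q ∈ cityTiles (tapeSite y)) :
    ∀ p ∈ CivVI.sites n J, ∀ q ∈ (f p).worked, q ∈ cityTiles p :=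
  h.forall_city (P := fun p c => ∀ q ∈ c.worked, q ∈ cityTiles p) hc
    (fun _ _ _ _ _ hq => List.mem_singleton.1 hq ▸ spot_mem_cityTiles ..)
    (fun _ _ _ hq => List.mem_singleton.1 hq ▸ spot_mem_cityTiles ..)

theorem _root_.List.sum_map_range_ite_lt (n k : ℕ) (h : k ≤ n) (a : ℕ) :
    ((List.range n).map fun j => if j < k then a else 0).sum = a * k := by
  obtain ⟨m, rfl⟩ := Nat.exists_eq_add_of_le h
  rw [List.range_add, List.map_append, List.sum_append, List.map_congr_left (g := fun _ => a),
    List.map_map, List.map_congr_left (l := List.range m) (g := fun _ => 0)]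
  · simp [mul_comm]
  · simp
  · intro j hj
    simp [List.mem_range.1 hj]

theorem faith_eq (r : Rules) (h : Rep n k J f g y c)
    (hc : ∀ q ∈ c.worked, q ∈ cityTiles (tapeSite y)) :
    (machineState n J f w st).faith r = r.baseFaith + 2 * k := by
  have h₁ : ((J.map f).map fun c =>
      (c.worked.map (machineState n J f w st).tileFaith).sum).sum = 0 := by
    rw [List.map_map]
    refine List.sum_eq_zero fun a ha => ?_
    obtain ⟨p, hp, rfl⟩ := List.mem_map.1 ha
    refine List.sum_eq_zero fun a ha => ?_
    obtain ⟨q, hq, rfl⟩ := List.mem_map.1 ha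
    have hq := h.worked_subset hc p (List.mem_append_left _ hp) q hq
    obtain ⟨x, rfl⟩ := h.sites p hp
    exact if_neg (notMem_monasteries hq)
  have h₂ : ∀ j < n, ((fun c : City => (c.worked.map (machineState n J f w st).tileFaith).sum) ∘ f ∘
      counterSite) j = if j < k then 2 else 0 := by
    intro j hj
    simp only [Function.comp_apply, h.counter j hj, mkCity, List.map_cons, List.map_nil,
      List.sum_singleton]
    by_cases hjk : j < k
    · have : counterSite j + spot true ∈ monasteries n :=
        List.mem_map.2 ⟨j, List.mem_range.2 hj, rfl⟩
      simp only [hjk, decide_true, if_true]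
      exact if_pos this
    · have : counterSite j + spot false ∉ monasteries n := by
        intro h'
        obtain ⟨i, -, e⟩ := List.mem_map.1 h'
        simp only [counterSite, spot, cond_true, cond_false, Prod.mk_add_mk, Prod.mk.injEq] at e
        omega
      simp only [hjk, decide_false, if_false]
      exact if_neg this
  have h₃ : (machineState n J f w st).cities = J.map f ++ (List.range n).map (f ∘ counterSite) := by
    simp [machineState, layoutState, CivVI.sites]
  rw [State.faith, h₃, List.map_append, List.sum_append, h₁, List.map_map, zero_add,
    List.map_congr_left fun j hj => h₂ j (List.mem_range.1 hj), List.sum_map_range_ite_lt _ _ h.le]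

theorem observe_eq (r : Rules) {pop fd cap pr : ℕ} {l : List Hex}
    (h : Rep n k J f g y (mkCity (tapeSite y) pop l fd cap pr))
    (hl : ∀ q ∈ l, q ∈ cityTiles (tapeSite y)) :
    observe r (machineState n J f (tapeSite y + spot true) st) =
      ⟨2 * k, decide (tapeSite y + spot true ∈ l), some (pop, spot true), st.isSome⟩ := by
  have h₁ := h.faith_eq (w := tapeSite y + spot true) (st := st) r hl
  have h₂ : ((machineState n J f (tapeSite y + spot true) st).cities.any fun c =>
      (machineState n J f (tapeSite y + spot true) st).worker ∈ c.worked) =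
      decide (tapeSite y + spot true ∈ l) := by
    rw [Bool.eq_iff_iff]
    simp only [machineState, layoutState, List.any_map, List.any_eq_true, Function.comp_apply,
      decide_eq_true_eq]
    constructor
    · rintro ⟨p, hp, hq⟩
      have := (h.isSite p hp).eq_of_mem (isSite_tapeSite y)
        (h.worked_subset hl p hp _ (of_decide_eq_true hq))
        (spot_mem_cityTiles _ _)
      rw [this, h.city] at hq
      exact of_decide_eq_true hq
    · intro hq
      exact ⟨_, h.mem_sites, by rw [h.city]; exact decide_eq_true hq⟩
  have h₃ : (machineState n J f (tapeSite y + spot true) st).cityAt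
      (machineState n J f (tapeSite y + spot true) st).worker = some (f (tapeSite y)) :=
    cityAt_layoutState h.layout h.isSite h.mem_sites (spot_mem_cityTiles _ _)
  rw [observe, h₁, h₂, h₃, h.city]
  simp [machineState, layoutState, mkCity]

theorem observe_eq_of_notMem (r : Rules) (h : Rep n k J f g y c)
    (hc : ∀ q ∈ c.worked, q ∈ cityTiles (tapeSite y)) {x : ℤ} (hx : tapeSite x ∉ J) :
    observe r (machineState n J f (tapeSite x + spot true) st) =
      ⟨2 * k, false, none, st.isSome⟩ := by
  have h₁ := h.faith_eq (w := tapeSite x + spot true) (st := st) r hc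
  have hx' : ∀ p ∈ CivVI.sites n J, tapeSite x + spot true ∉ cityTiles p := by
    intro p hp hq
    have := (h.isSite p hp).eq_of_mem (isSite_tapeSite x) hq (spot_mem_cityTiles _ _)
    subst this
    rcases List.mem_append.1 hp with hp | hp
    · exact hx hp
    · obtain ⟨j, -, e⟩ := List.mem_map.1 hp
      exact counterSite_ne_tapeSite _ _ e
  have h₂ : ((machineState n J f (tapeSite x + spot true) st).cities.any fun c =>
      (machineState n J f (tapeSite x + spot true) st).worker ∈ c.worked) = false := by
    simp only [machineState, layoutState, List.any_map, List.any_eq_false, Function.comp_apply]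
    exact fun p hp hq => hx' p hp (h.worked_subset hc p hp _ (of_decide_eq_true hq))
  have h₃ : (machineState n J f (tapeSite x + spot true) st).cityAt
      (machineState n J f (tapeSite x + spot true) st).worker = none :=
    cityAt_layoutState_eq_none h.layout hx'
  rw [observe, h₁, h₂, h₃]
  simp [machineState, layoutState]

theorem reassign_counter (h : Rep n k J f g y c) {j : ℕ} (hj : j < n) (hjk : j ≤ k) {k' : ℕ}
    (hk' : k' = if j < k then j else k + 1) (hjk' : j + 1 = k ∨ j = k) :
    ∃ f', reassign (machineState n J f w st) (counterSite j + spot (decide (j < k)))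
        (counterSite j + spot (!decide (j < k))) = some (machineState n J f' w st) ∧
      Rep n k' J f' g y c := by
  have hmem : counterSite j ∈ CivVI.sites n J :=
    List.mem_append_right _ (List.mem_map.2 ⟨j, List.mem_range.2 hj, rfl⟩)
  have hw : (f (counterSite j)).worked = [counterSite j + spot (decide (j < k))] := by
    rw [h.counter j hj]
    rfl
  refine ⟨_, reassign_layoutState h.layout h.isSite hmem hw, ?_, h.sites, ?_, ?_, h.mem, ?_, ?_,
    h.blank⟩
  · exact h.layout.update (h.layout _).1 (h.layout _).2
  · have := h.le
    split_ifs at hk' <;> omega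
  · intro i hi
    by_cases e : i = j
    · subst e
      rw [Function.update_self, h.counter i hi]
      have : (!decide (i < k)) = decide (i < k') := by
        split_ifs at hk' with hik <;> simp [hik] <;> omega
      rw [this]
      rfl
    · rw [Function.update_of_ne (counterSite_inj.not.2 e), h.counter i hi]
      have : (i < k) ↔ (i < k') := by
        split_ifs at hk' <;> omega
      simp only [this]
  · rw [Function.update_of_ne (counterSite_ne_tapeSite j y).symm, h.city]
  · intro x hx hxJ
    rw [Function.update_of_ne (counterSite_ne_tapeSite j x).symm]
    exact h.cells x hx hxJ

end Rep

end CivVI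


namespace CivVI

/-- The orders of an idle turn. -/
def noOrder : Order := ⟨none, none, [], [], none⟩

/-- Move the Worker. -/
def moveOrder (d : HexDir) : Order := { noOrder with worker := some d }

/-- Move the Settler. -/
def moveSettlerOrder (d : HexDir) : Order := { noOrder with settler := some (.move d) }

/-- Move the Citizen between the two tiles on which it can show a symbol. -/
def flipOrder (b : Bool) : Order :=
  { noOrder with citizens :=
      [(.fromWorker (spot b - spot true), .fromWorker (spot (!b) - spot true))] }

/-- Cap the growth of the City next to the Worker. -/
def capOrder (k : ℕ) : Order := { noOrder with caps := [(.fromWorker 0, k)] }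

/-- Train a Settler in the City next to the Worker. -/
def trainOrder (b : Bool) : Order :=
  { noOrder with train := some (.fromWorker 0, .fromWorker (spot b - spot true)) }

/-- The reassignment of a Citizen that shows a digit of the counter. -/
def digitOrder (j : ℕ) (b : Bool) : TileRef × TileRef :=
  (.absolute (counterSite j + spot b), .absolute (counterSite j + spot !b))

/-- Change the value of the counter. -/
def counterOrder (k k' : ℕ) : Order :=
  { noOrder with citizens := ((List.range k).reverse.map fun j => digitOrder j true) ++
      (List.range k').map fun j => digitOrder j false }

/-- The step on the tape in a direction. -/
def step : Turing.Dir → ℤ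
  | .left => -1
  | .right => 1

/-- The opposite direction. -/
def opposite : Turing.Dir → Turing.Dir
  | .left => .right
  | .right => .left

theorem step_opposite (d : Turing.Dir) : step (opposite d) = -step d := by cases d <;> rfl

/-- Found a City on the next tile of the tape in a direction. -/
def foundOrder (d : Turing.Dir) : Order :=
  { noOrder with
    settler := some .found
    citizens := [(.fromWorker (4 * step d, 0),
      .fromWorker ((4 * step d, 0) + (spot false - spot true)))]
    caps := [(.fromWorker (4 * step d, 0), 2)] }

theorem turn_citizens (r : Rules) {cs : List (TileRef × TileRef)} {s s' : State}
    (h : cs.foldlM (fun s x => reassign s (s.tile x.1) (s.tile x.2)) s = some s')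
    (hs : { s' with cities := s'.cities.map (s'.grow r) } = s') :
    turn r s { noOrder with citizens := cs } = some s' := by
  simp only [turn, noOrder, h, List.foldlM_nil, Option.bind_eq_bind, Option.bind_some,
    Option.pure_def, hs]

namespace Rep

variable {n k : ℕ} {J : List Hex} {f : Hex → City} {g : ℤ → Bool} {y : ℤ} {c : City} {w : Hex}
  {st : Option Hex} (r : Rules)

theorem endTurn (h : Rep n k J f g y c) (hc : c.Capped) :
    { machineState n J f w st with
      cities := (machineState n J f w st).cities.map ((machineState n J f w st).grow r) } =
    machineState n J f w st :=
  endTurn_layoutState r (h.capped hc)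

theorem run_moveOrder (h : Rep n k J f g y c) (hc : c.Capped) (d : Turing.Dir) (x : ℤ) :
    (game r).Run (List.replicate 4 (moveOrder d.toHexDir))
      (machineState n J f (tapeSite x + spot true) st)
      (machineState n J f (tapeSite (x + step d) + spot true) st) := by
  have h₁ (w : Hex) : (game r).turn (machineState n J f w st) (moveOrder d.toHexDir) =
      some (machineState n J f (w + d.toHexDir.vec) st) :=
    congrArg some (h.endTurn (w := w + d.toHexDir.vec) r hc)
  have h₂ : tapeSite (x + step d) + spot true = tapeSite x + spot true + d.toHexDir.vec +
      d.toHexDir.vec + d.toHexDir.vec + d.toHexDir.vec := by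
    cases d <;> simp [tapeSite, step, spot, Turing.Dir.toHexDir, HexDir.vec] <;> ring
  rw [h₂]
  simp [CivGame.Run, List.replicate, h₁]

theorem run_moveSettlerOrder (h : Rep n k J f g y c) (hc : c.Capped) (d : Turing.Dir) (x : ℤ) :
    (game r).Run (List.replicate 4 (moveSettlerOrder d.toHexDir))
      (machineState n J f w (some (tapeSite x)))
      (machineState n J f w (some (tapeSite (x + step d)))) := by
  have h₁ (p : Hex) : (game r).turn (machineState n J f w (some p)) (moveSettlerOrder d.toHexDir) =
      some (machineState n J f w (some (p + d.toHexDir.vec))) :=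
    congrArg some (h.endTurn (st := some (p + d.toHexDir.vec)) r hc)
  have h₂ : tapeSite (x + step d) = tapeSite x + d.toHexDir.vec +
      d.toHexDir.vec + d.toHexDir.vec + d.toHexDir.vec := by
    cases d <;> simp [tapeSite, step, Turing.Dir.toHexDir, HexDir.vec] <;> ring
  rw [h₂]
  simp [CivGame.Run, List.replicate, h₁]

theorem foldlM_down (h : Rep n k J f g y c) : ∃ f',
    ((List.range k).reverse.map fun j => digitOrder j true).foldlM
      (fun s x => reassign s (s.tile x.1) (s.tile x.2)) (machineState n J f w st) =
        some (machineState n J f' w st) ∧ Rep n 0 J f' g y c := by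
  induction k generalizing f with
  | zero => exact ⟨f, rfl, h⟩
  | succ k ih =>
    obtain ⟨f₁, h₁, h₂⟩ := h.reassign_counter (w := w) (st := st) (j := k) (k' := k) h.le (by omega)
      (by simp) (.inl rfl)
    obtain ⟨f₂, h₃, h₄⟩ := ih h₂
    refine ⟨f₂, ?_, h₄⟩
    have h₁' : reassign (machineState n J f w st) (counterSite k + spot true)
        (counterSite k + spot !true) = some (machineState n J f₁ w st) := by simpa using h₁
    rw [List.range_succ, List.reverse_append, List.reverse_singleton, List.singleton_append,
      List.map_cons, List.foldlM_cons]
    simp only [digitOrder, State.tile, h₁', Option.bind_eq_bind, Option.bind_some]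
    exact h₃

theorem foldlM_up (h : Rep n 0 J f g y c) {k : ℕ} (hk : k ≤ n) : ∃ f',
    ((List.range k).map fun j => digitOrder j false).foldlM
      (fun s x => reassign s (s.tile x.1) (s.tile x.2)) (machineState n J f w st) =
        some (machineState n J f' w st) ∧ Rep n k J f' g y c := by
  induction k with
  | zero => exact ⟨f, rfl, h⟩
  | succ k ih =>
    obtain ⟨f₁, h₁, h₂⟩ := ih (by omega)
    obtain ⟨f₂, h₃, h₄⟩ := h₂.reassign_counter (w := w) (st := st) (j := k) (k' := k + 1) hk le_rfl
      (by simp) (.inr rfl)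
    refine ⟨f₂, ?_, h₄⟩
    have h₃' : reassign (machineState n J f₁ w st) (counterSite k + spot false)
        (counterSite k + spot !false) = some (machineState n J f₂ w st) := by simpa using h₃
    rw [List.range_succ, List.map_append, List.foldlM_append, h₁]
    simpa [digitOrder, State.tile] using h₃'

theorem run_counterOrder (h : Rep n k J f g y c) (hc : c.Capped) {k' : ℕ} (hk' : k' ≤ n) :
    ∃ f', (game r).Run [counterOrder k k'] (machineState n J f w st) (machineState n J f' w st) ∧
      Rep n k' J f' g y c := by
  obtain ⟨f₁, h₁, h₂⟩ := h.foldlM_down (w := w) (st := st)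
  obtain ⟨f₂, h₃, h₄⟩ := h₂.foldlM_up (w := w) (st := st) hk'
  refine ⟨f₂, .single (turn_citizens r ?_ (h₄.endTurn r hc)), h₄⟩
  rw [List.foldlM_append, h₁]
  exact h₃

theorem run_flipOrder {b : Bool} {fd pr : ℕ}
    (h : Rep n k J f g y (cell y b fd pr)) {g' : ℤ → Bool} (hg : ∀ x ≠ y, g' x = g x) :
    ∃ f', (game r).Run [flipOrder b] (machineState n J f (tapeSite y + spot true) st)
      (machineState n J f' (tapeSite y + spot true) st) ∧
        Rep n k J f' g' y (cell y (!b) fd pr) := by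
  have hw : (f (tapeSite y)).worked = [tapeSite y + spot b] := by rw [h.city]; rfl
  have h₁ : { f (tapeSite y) with worked := [tapeSite y + spot !b] } = cell y (!b) fd pr := by
    rw [h.city]
    rfl
  have h₂ := reassign_layoutState (mon := monasteries n) (w := tapeSite y + spot true) (st := st)
    h.layout h.isSite h.mem_sites hw
  rw [h₁] at h₂
  have h₃ := h.update (c' := cell y (!b) fd pr) rfl rfl hg
  refine ⟨_, .single (turn_citizens r ?_ (h₃.endTurn r (mkCity_capped le_rfl))), h₃⟩
  have h₄ (b : Bool) : (machineState n J f (tapeSite y + spot true) st).tile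
      (.fromWorker (spot b - spot true)) = tapeSite y + spot b :=
    add_add_sub_cancel ..
  simp only [List.foldlM_cons, h₄]
  rw [show reassign (machineState n J f (tapeSite y + spot true) st) _ _ = _ from h₂]
  rfl

theorem setCap_eq {pop fd cap pr k' : ℕ} {l : List Hex}
    (h : Rep n k J f g y (mkCity (tapeSite y) pop l fd cap pr)) {p : Hex}
    (hp : p ∈ cityTiles (tapeSite y)) : ∃ f',
    setCap (machineState n J f w st) p k' = some (machineState n J f' w st) ∧
      Rep n k J f' g y (mkCity (tapeSite y) pop l fd k' pr) := by
  refine ⟨_, setCap_layoutState h.layout h.isSite h.mem_sites hp k', ?_⟩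
  rw [h.city]
  exact h.update rfl rfl fun _ _ => rfl

theorem turn_capOrder {pop fd cap pr k' : ℕ} {l : List Hex}
    (h : Rep n k J f g y (mkCity (tapeSite y) pop l fd cap pr)) : ∃ f',
    (game r).turn (machineState n J f (tapeSite y + spot true) st) (capOrder k') =
      some { machineState n J f' (tapeSite y + spot true) st with
        cities := (machineState n J f' (tapeSite y + spot true) st).cities.map
          ((machineState n J f' (tapeSite y + spot true) st).grow r) } ∧
      Rep n k J f' g y (mkCity (tapeSite y) pop l fd k' pr) := by
  have hp : tapeSite y + spot true + 0 ∈ cityTiles (tapeSite y) := by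
    rw [add_zero]
    exact spot_mem_cityTiles _ _
  obtain ⟨f', h₁, h₂⟩ := h.setCap_eq (w := tapeSite y + spot true) (st := st) (k' := k') hp
  refine ⟨f', ?_, h₂⟩
  have h₁' : setCap (machineState n J f (tapeSite y + spot true) st)
      ((machineState n J f (tapeSite y + spot true) st).tile (.fromWorker 0)) k' =
        some (machineState n J f' (tapeSite y + spot true) st) := h₁
  simp [game, turn, capOrder, noOrder, h₁']

theorem run_capOrder {pop fd cap pr k' : ℕ} {l : List Hex}
    (h : Rep n k J f g y (mkCity (tapeSite y) pop l fd cap pr)) (hk' : k' ≤ pop) :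
    ∃ f', (game r).Run [capOrder k'] (machineState n J f (tapeSite y + spot true) st)
      (machineState n J f' (tapeSite y + spot true) st) ∧
        Rep n k J f' g y (mkCity (tapeSite y) pop l fd k' pr) := by
  obtain ⟨f', h₁, h₂⟩ := h.turn_capOrder (st := st) (k' := k') r
  rw [h₂.endTurn r (mkCity_capped hk')] at h₁
  exact ⟨f', .single h₁, h₂⟩

theorem run_capOrder_two {fd cap pr : ℕ}
    (h : Rep n k J f g y (mkCity (tapeSite y) 1 [] fd cap pr)) :
    ∃ f', (game r).Run [capOrder 2] (machineState n J f (tapeSite y + spot true) st)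
      (machineState n J f' (tapeSite y + spot true) st) ∧
        Rep n k J f' g y (if r.growthFood 1 ≤ fd + 2 then
          mkCity (tapeSite y) 2 [tapeSite y + spot true] (fd + 2 - r.growthFood 1) 2 pr
        else mkCity (tapeSite y) 1 [] (fd + 2) 2 pr) := by
  obtain ⟨f', h₁, h₂⟩ := h.turn_capOrder (st := st) (k' := 2) r
  rw [show ({ machineState n J f' (tapeSite y + spot true) st with
        cities := (machineState n J f' (tapeSite y + spot true) st).cities.map
          ((machineState n J f' (tapeSite y + spot true) st).grow r) } : State) = _ from
      endTurn_layoutState_of_ne r h₂.capped_of_ne, h₂.city,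
    show (tapeSite y) = (4 * y, 0) from rfl,
    grow_mkCity_one r (fun h hh => notMem_monasteries (x := y) hh)] at h₁
  refine ⟨_, .single h₁, ?_⟩
  split_ifs
  · exact h₂.update rfl rfl fun _ _ => rfl
  · exact h₂.update rfl rfl fun _ _ => rfl

theorem run_trainOrder {b : Bool} {fd pr : ℕ}
    (h : Rep n k J f g y (mkCity (tapeSite y) 2 [tapeSite y + spot b] fd 1 pr)) :
    ∃ f', if 30 * (CivVI.sites n J).length + 50 ≤ pr + r.production then
      (game r).Run [trainOrder b] (machineState n J f (tapeSite y + spot true) none)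
        (machineState n J f' (tapeSite y + spot true) (some (tapeSite y))) ∧
        Rep n k J f' g y (mkCity (tapeSite y) 1 [] fd 1 0)
    else (game r).Run [trainOrder b] (machineState n J f (tapeSite y + spot true) none)
        (machineState n J f' (tapeSite y + spot true) none) ∧
        Rep n k J f' g y
          (mkCity (tapeSite y) 2 [tapeSite y + spot b] fd 1 (pr + r.production)) := by
  have hp : tapeSite y + spot true + 0 ∈ cityTiles (tapeSite y) := by
    rw [add_zero]
    exact spot_mem_cityTiles _ _
  have h₁ := train_layoutState (mon := monasteries n) (w := tapeSite y + spot true) r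
    h.layout h.isSite h.mem_sites h.city hp
  have h₂ : (machineState n J f (tapeSite y + spot true) none).tile
      (.fromWorker (spot b - spot true)) = tapeSite y + spot b :=
    add_add_sub_cancel ..
  split_ifs with hcost
  · rw [if_pos hcost] at h₁
    have h₃ := h.update (c' := mkCity (tapeSite y) 1 [] fd 1 0) rfl rfl fun _ _ => rfl
    refine ⟨_, .single ?_, h₃⟩
    have h₁' : CivVI.train r (machineState n J f (tapeSite y + spot true) none)
      ((machineState n J f (tapeSite y + spot true) none).tile (.fromWorker 0))
      (tapeSite y + spot b) = some (machineState n J _ _ _) := h₁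
    simp only [game, turn, trainOrder, noOrder, List.foldlM_nil, Option.bind_eq_bind,
      Option.bind_some, Option.pure_def, h₂, h₁']
    rw [h₃.endTurn r (mkCity_capped le_rfl)]
  · rw [if_neg hcost] at h₁
    have h₃ := h.update (c' := mkCity (tapeSite y) 2 [tapeSite y + spot b] fd 1 (pr + r.production))
      rfl rfl fun _ _ => rfl
    refine ⟨_, .single ?_, h₃⟩
    have h₁' : CivVI.train r (machineState n J f (tapeSite y + spot true) none)
      ((machineState n J f (tapeSite y + spot true) none).tile (.fromWorker 0))
      (tapeSite y + spot b) = some (machineState n J _ _ _) := h₁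
    simp only [game, turn, trainOrder, noOrder, List.foldlM_nil, Option.bind_eq_bind,
      Option.bind_some, Option.pure_def, h₂, h₁']
    rw [h₃.endTurn r (mkCity_capped one_le_two)]

theorem run_foundOrder (h : Rep n k J f g y c) (hc : c.Capped) {d : Turing.Dir}
    (hd : tapeSite (y + step d) ∉ J) :
    ∃ f', (game r).Run [foundOrder d]
      (machineState n J f (tapeSite y + spot true) (some (tapeSite (y + step d))))
      (machineState n (tapeSite (y + step d) :: J) f' (tapeSite y + spot true) none) ∧
        Rep n k (tapeSite (y + step d) :: J) f' g y c := by
  set x := y + step d with hx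
  have hxy : x ≠ y := by cases d <;> simp [hx, step]
  set I := CivVI.sites n (tapeSite x :: J) with hI
  have hxI : tapeSite x ∉ CivVI.sites n J := by
    intro hp
    rcases List.mem_append.1 hp with hp | hp
    · exact hd hp
    · obtain ⟨j, -, e⟩ := List.mem_map.1 hp
      exact counterSite_ne_tapeSite _ _ e
  have hIs : ∀ p ∈ I, IsSite p := by
    intro p hp
    rcases List.mem_cons.1 hp with rfl | hp
    · exact isSite_tapeSite x
    · exact h.isSite p hp
  have hxI' : tapeSite x ∈ I := List.mem_cons_self
  have hw : ∀ b, tapeSite y + spot true + ((4 * step d, 0) + (spot b - spot true)) =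
      tapeSite x + spot b := by
    intro b
    have : tapeSite x = tapeSite y + (4 * step d, 0) := by
      simp [tapeSite, hx]
      ring
    rw [this]
    abel
  have hw' : tapeSite y + spot true + (4 * step d, 0) = tapeSite x + spot true := by
    simpa using hw true
  have h₁ := found_layoutState (w := tapeSite y + spot true) h.layout h.isSite (isSite_tapeSite x)
    hxI fun p hp => notMem_monasteries (n := n) (x := x) hp
  set c₁ : City := { mkCity (4 * x, 0) 2 [((4 * x, 0) : Hex) + spot true] 0 0 0 with cap := none }
  have hf₁ : Layout (Function.update f (tapeSite x) c₁) := h.layout.update rfl rfl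
  have h₂ := reassign_layoutState (mon := monasteries n) (w := tapeSite y + spot true)
    (st := none) (b := true) hf₁ hIs hxI' (by rw [Function.update_self]; rfl)
  rw [Function.update_self, Function.update_idem] at h₂
  set c₂ : City := { c₁ with worked := [tapeSite x + spot !true] }
  have hf₂ : Layout (Function.update f (tapeSite x) c₂) := h.layout.update rfl rfl
  have h₃ := setCap_layoutState (mon := monasteries n) (w := tapeSite y + spot true)
    (st := none) hf₂ hIs hxI' (spot_mem_cityTiles _ true) 2
  rw [Function.update_self, Function.update_idem] at h₃
  have hc₃ : ({ c₂ with cap := some 2 } : City) = cell x false 0 0 := rfl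
  rw [hc₃] at h₃
  have hR : Rep n k (tapeSite x :: J) (Function.update f (tapeSite x) (cell x false 0 0)) g y c :=
    { layout := h.layout.update rfl rfl
      sites := by
        intro p hp
        rcases List.mem_cons.1 hp with rfl | hp
        · exact ⟨x, rfl⟩
        · exact h.sites p hp
      le := h.le
      counter := fun j hj => by
        rw [Function.update_of_ne (counterSite_ne_tapeSite j x), h.counter j hj]
      mem := List.mem_cons_of_mem _ h.mem
      city := by rw [Function.update_of_ne (tapeSite_inj.not.2 hxy.symm), h.city]
      cells := by
        intro z hz hzJ
        by_cases e : z = x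
        · subst e
          exact ⟨0, 0, by rw [Function.update_self, h.blank _ hd]⟩
        · rw [Function.update_of_ne (tapeSite_inj.not.2 e)]
          exact h.cells z hz ((List.mem_cons.1 hzJ).resolve_left (tapeSite_inj.not.2 e))
      blank := fun z hz => h.blank z fun hz' => hz (List.mem_cons_of_mem _ hz') }
  refine ⟨_, .single ?_, hR⟩
  have h₁' : settlerTurn (machineState n J f (tapeSite y + spot true) (some (tapeSite x))) .found =
    some (layoutState I (Function.update f (tapeSite x) c₁) (monasteries n)
      (tapeSite y + spot true) none) := h₁
  have ht₁ (f' : Hex → City) : (layoutState I f' (monasteries n) (tapeSite y + spot true) none).tile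
      (.fromWorker (4 * step d, 0)) = tapeSite x + spot true := hw'
  have ht₂ (f' : Hex → City) : (layoutState I f' (monasteries n) (tapeSite y + spot true) none).tile
      (.fromWorker ((4 * step d, 0) + (spot false - spot true))) = tapeSite x + spot !true :=
    hw false
  simp only [game, turn, foundOrder, noOrder, List.foldlM_nil, List.foldlM_cons, h₁',
    Option.bind_eq_bind, Option.bind_some, Option.pure_def, ht₁, ht₂, h₂, h₃]
  exact congrArg some (hR.endTurn r hc)

end Rep

end CivVI


namespace CivVI

open Turing Relation

/-- What the player is doing: running the machine, going back to the last City of the tape, training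
a Settler in it while its Citizen shows a symbol, and waiting for a new Citizen to replace the
Settler. -/
inductive Phase
  | run
  | back
  | train (b : Bool)
  | grow (b : Bool)
  deriving DecidableEq

instance : Fintype Phase where
  elems := {.run, .back, .train true, .train false, .grow true, .grow false}
  complete := by rintro (_ | _ | (_ | _) | (_ | _)) <;> simp

instance : Fintype Dir where
  elems := {.left, .right}
  complete := by rintro (_ | _) <;> simp

/-- The value of the counter encodes the state of the machine, the direction of the last move, and
the phase. -/
abbrev Mode (n : ℕ) := Fin (n + 1) × Dir × Phase

/-- The number of modes. -/
def numModes (n : ℕ) : ℕ := Fintype.card (Mode n)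

/-- The value of the counter that encodes a mode. -/
noncomputable def code {n : ℕ} (m : Mode n) : ℕ := (Fintype.equivFin (Mode n) m).val

theorem code_le {n : ℕ} (m : Mode n) : code m ≤ numModes n :=
  (Fintype.equivFin (Mode n) m).isLt.le

theorem code_inj {n : ℕ} {m m' : Mode n} : code m = code m' ↔ m = m' := by
  simp [code, Fin.val_inj]

/-- What the table distinguishes: the mode, whether the tile of the Worker is being worked,
the City next to the Worker (`true` if it has two Citizens), and whether there is a Settler. -/
abbrev Key (n : ℕ) := Mode n × Bool × Option Bool × Bool

/-- The observation described by a key. -/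
noncomputable def keyObs {n : ℕ} (k : Key n) : Obs :=
  ⟨2 * code k.1, k.2.1, k.2.2.1.map fun e => (cond e 2 1, spot true), k.2.2.2⟩

theorem keyObs_injective (n : ℕ) : Function.Injective (keyObs (n := n)) := by
  rintro ⟨m, b, o, s⟩ ⟨m', b', o', s'⟩ h
  simp only [keyObs, Obs.mk.injEq] at h
  obtain ⟨h₁, rfl, h₂, rfl⟩ := h
  have h₃ : m = m' := code_inj.1 (by omega)
  have h₄ : o = o' := by
    rcases o with _ | _ | _ <;> rcases o' with _ | _ | _ <;> simp at h₂ <;> rfl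
  rw [h₃, h₄]

/-- The orders of an action of the machine. -/
noncomputable def act {n : ℕ} (q : Fin (n + 1)) (d : Dir) (b : Bool) (q' : Fin (n + 1)) :
    TM0.Stmt Bool → List Order
  | .move d' => List.replicate 4 (moveOrder d'.toHexDir) ++
      [counterOrder (code (q, d, Phase.run)) (code (q', d', Phase.run))]
  | .write a => (if b = a then [] else [flipOrder b]) ++
      [counterOrder (code (q, d, Phase.run)) (code (q', d, Phase.run))]

/-- The commands of the table. -/
noncomputable def command {n : ℕ} (M : TM0.Machine Bool (Fin (n + 1))) :
    Key n → Option (List Order)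
  | ((q, d, .run), b, some true, false) => (M q b).map fun x => act q d b x.1 x.2
  | ((q, d, .run), _, none, false) => some (List.replicate 4 (moveOrder (opposite d).toHexDir) ++
      [counterOrder (code (q, d, Phase.run)) (code (q, d, Phase.back))])
  | ((q, d, .back), b, some true, false) => some ([capOrder 1] ++
      [counterOrder (code (q, d, Phase.back)) (code (q, d, Phase.train b))])
  | ((_, _, .train b), _, some true, false) => some [trainOrder b]
  | ((q, d, .train b), _, some false, true) =>
      some (List.replicate 4 (moveSettlerOrder d.toHexDir) ++ ([foundOrder d] ++
        [counterOrder (code (q, d, Phase.train b)) (code (q, d, Phase.grow b))]))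
  | ((_, _, .grow _), _, some false, false) => some [capOrder 2]
  | ((q, d, .grow b), _, some true, false) => some ((if b then [] else [flipOrder true]) ++
      (List.replicate 4 (moveOrder d.toHexDir) ++
        [counterOrder (code (q, d, Phase.grow b)) (code (q, d, Phase.run))]))
  | _ => none

/-- The command table that simulates a machine. -/
noncomputable def table {n : ℕ} (M : TM0.Machine Bool (Fin (n + 1))) : CommandTable Obs Order :=
  CivGame.mkTable keyObs (command M)

section simulation

variable (r : Rules) {n : ℕ} (M : TM0.Machine Bool (Fin (n + 1))) {J : List Hex} {f : Hex → City}
  {g : ℤ → Bool} {y : ℤ} {st : Option Hex} {m : Mode n}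

theorem lookup_table {e b : Bool} {fd cap pr : ℕ} {l : List Hex}
    (h : Rep (numModes n) (code m) J f g y (mkCity (tapeSite y) (cond e 2 1) l fd cap pr))
    (hl : ∀ q ∈ l, q ∈ cityTiles (tapeSite y)) (hb : decide (tapeSite y + spot true ∈ l) = b) :
    (table M).lookup ((game r).observe
      (machineState (numModes n) J f (tapeSite y + spot true) st)) =
      command M (m, b, some e, st.isSome) := by
  have h₁ := h.observe_eq (st := st) r hl
  rw [hb] at h₁
  exact (congrArg (fun o => (table M).lookup o) h₁).trans
    (CivGame.lookup_mkTable (keyObs_injective n) (command M) (m, b, some e, st.isSome))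

theorem lookup_table_of_notMem {c : City} (h : Rep (numModes n) (code m) J f g y c)
    (hc : ∀ q ∈ c.worked, q ∈ cityTiles (tapeSite y)) {x : ℤ} (hx : tapeSite x ∉ J) :
    (table M).lookup ((game r).observe
      (machineState (numModes n) J f (tapeSite x + spot true) st)) =
      command M (m, false, none, st.isSome) :=
  (congrArg (fun o => (table M).lookup o) (h.observe_eq_of_notMem (st := st) r hc hx)).trans
    (CivGame.lookup_mkTable (keyObs_injective n) (command M) (m, false, none, st.isSome))

theorem mem_cityTiles_of_mem_spot {p : Hex} {b : Bool} :
    ∀ q ∈ [p + spot b], q ∈ cityTiles p :=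
  fun _ hq => List.mem_singleton.1 hq ▸ spot_mem_cityTiles ..

theorem decide_mem_spot {p : Hex} {b : Bool} : decide (p + spot true ∈ [p + spot b]) = b := by
  cases b <;> simp [spot]

/-- A City trains a Settler. -/
theorem reflTransGen_train {b : Bool} {fd pr : ℕ} {q : Fin (n + 1)} {d : Dir}
    (h : Rep (numModes n) (code (q, d, Phase.train b)) J f g y
      (mkCity (tapeSite y) 2 [tapeSite y + spot b] fd 1 pr)) :
    ∃ f', ReflTransGen ((game r).Round (table M))
      (machineState (numModes n) J f (tapeSite y + spot true) none)
      (machineState (numModes n) J f' (tapeSite y + spot true) (some (tapeSite y))) ∧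
      Rep (numModes n) (code (q, d, Phase.train b)) J f' g y (mkCity (tapeSite y) 1 [] fd 1 0) := by
  induction hN : 30 * (sites (numModes n) J).length + 50 - pr using Nat.strong_induction_on
    generalizing f pr with
  | _ N ih =>
    have hT : (table M).lookup ((game r).observe
        (machineState (numModes n) J f (tapeSite y + spot true) none)) = some [trainOrder b] :=
      lookup_table r M (e := true) h mem_cityTiles_of_mem_spot decide_mem_spot
    obtain ⟨f₁, h₁⟩ := h.run_trainOrder r
    have := r.production_pos
    split_ifs at h₁ with hcost
    · exact ⟨f₁, .single (h₁.1.round hT), h₁.2⟩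
    · obtain ⟨f₂, h₂, h₃⟩ := ih _ (by omega) h₁.2 rfl
      exact ⟨f₂, .head (h₁.1.round hT) h₂, h₃⟩

/-- A City waits until a new Citizen is born. -/
theorem reflTransGen_grow {b : Bool} {fd cap pr : ℕ} {q : Fin (n + 1)} {d : Dir}
    (h : Rep (numModes n) (code (q, d, Phase.grow b)) J f g y
      (mkCity (tapeSite y) 1 [] fd cap pr)) :
    ∃ f' fd', ReflTransGen ((game r).Round (table M))
      (machineState (numModes n) J f (tapeSite y + spot true) none)
      (machineState (numModes n) J f' (tapeSite y + spot true) none) ∧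
      Rep (numModes n) (code (q, d, Phase.grow b)) J f' g y (cell y true fd' pr) := by
  induction hN : r.growthFood 1 - fd using Nat.strong_induction_on generalizing f fd cap with
  | _ N ih =>
    have hT : (table M).lookup ((game r).observe
        (machineState (numModes n) J f (tapeSite y + spot true) none)) = some [capOrder 2] :=
      lookup_table r M (e := false) h (by simp) rfl
    obtain ⟨f₁, h₁, h₂⟩ := h.run_capOrder_two (st := none) r
    split_ifs at h₂ with hfd
    · exact ⟨f₁, _, .single (h₁.round hT), h₂⟩
    · obtain ⟨f₂, fd', h₃, h₄⟩ := ih _ (by omega) h₂ rfl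
      exact ⟨f₂, fd', .head (h₁.round hT) h₃, h₄⟩

/-- After a move of the machine, a City is founded at the position of the head if necessary. -/
theorem exists_reflTransGen_arrive {fd pr : ℕ} {q : Fin (n + 1)} {d : Dir}
    (h : Rep (numModes n) (code (q, d, Phase.run)) J f g y (cell y (g y) fd pr)) :
    ∃ J' f' fd' pr', ReflTransGen ((game r).Round (table M))
      (machineState (numModes n) J f (tapeSite (y + step d) + spot true) none)
      (machineState (numModes n) J' f' (tapeSite (y + step d) + spot true) none) ∧
      Rep (numModes n) (code (q, d, Phase.run)) J' f' g (y + step d)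
        (cell (y + step d) (g (y + step d)) fd' pr') := by
  by_cases hd : tapeSite (y + step d) ∈ J
  · obtain ⟨fd', pr', h'⟩ := h.focus hd
    exact ⟨J, f, fd', pr', .refl, h'⟩
  have hcell {b : Bool} {fd cap pr : ℕ} (hcap : cap ≤ 2) :
      (mkCity (tapeSite y) 2 [tapeSite y + spot b] fd cap pr).Capped := mkCity_capped hcap
  have hmove := h.run_moveOrder r (hcell le_rfl) (opposite d) (y + step d) (st := none)
  rw [step_opposite, add_neg_cancel_right] at hmove
  obtain ⟨f₁, h₁, R₁⟩ := h.run_counterOrder (w := tapeSite y + spot true) (st := none) r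
    (hcell le_rfl) (code_le (q, d, Phase.back))
  have t₁ := (hmove.append h₁).round (T := table M)
    (lookup_table_of_notMem r M h mem_cityTiles_of_mem_spot hd)
  obtain ⟨f₂, h₂, R₂⟩ := R₁.run_capOrder (st := none) (k' := 1) r one_le_two
  obtain ⟨f₃, h₃, R₃⟩ := R₂.run_counterOrder (w := tapeSite y + spot true) (st := none) r
    (hcell one_le_two) (code_le (q, d, Phase.train (g y)))
  have t₂ := (h₂.append h₃).round (T := table M)
    (lookup_table r M (e := true) R₁ mem_cityTiles_of_mem_spot decide_mem_spot)
  obtain ⟨f₄, t₃, R₄⟩ := reflTransGen_train r M R₃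
  have hcity {fd cap pr : ℕ} (hcap : cap ≤ 1) : (mkCity (tapeSite y) 1 [] fd cap pr).Capped :=
    mkCity_capped hcap
  have hsettler := R₄.run_moveSettlerOrder (w := tapeSite y + spot true) r (hcity le_rfl) d y
  obtain ⟨f₅, h₅, R₅⟩ := R₄.run_foundOrder r (hcity le_rfl) hd
  obtain ⟨f₆, h₆, R₆⟩ := R₅.run_counterOrder (w := tapeSite y + spot true) (st := none) r
    (hcity le_rfl) (code_le (q, d, Phase.grow (g y)))
  have t₄ := (hsettler.append (h₅.append h₆)).round (T := table M)
    (lookup_table r M (e := false) R₄ (by simp) rfl)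
  obtain ⟨f₇, fd₇, t₅, R₇⟩ := reflTransGen_grow r M R₆
  obtain ⟨f₈, h₈, R₈⟩ : ∃ f₈, (game r).Run (if g y then [] else [flipOrder true])
      (machineState (numModes n) (tapeSite (y + step d) :: J) f₇ (tapeSite y + spot true) none)
      (machineState (numModes n) (tapeSite (y + step d) :: J) f₈ (tapeSite y + spot true) none) ∧
      Rep (numModes n) (code (q, d, Phase.grow (g y))) (tapeSite (y + step d) :: J) f₈ g y
        (cell y (g y) fd₇ 0) := by
    generalize code (q, d, Phase.grow (g y)) = K at R₇ ⊢
    cases g y with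
    | true => exact ⟨f₇, .nil _, R₇⟩
    | false => exact R₇.run_flipOrder (st := none) r fun _ _ => rfl
  have hmove' := R₈.run_moveOrder (st := none) r (hcell le_rfl) d y
  obtain ⟨f₉, h₉, R₉⟩ := R₈.run_counterOrder (w := tapeSite (y + step d) + spot true) (st := none)
    r (hcell le_rfl) (code_le (q, d, Phase.run))
  have t₆ := (h₈.append (hmove'.append h₉)).round (T := table M)
    (lookup_table r M (e := true) R₇ mem_cityTiles_of_mem_spot decide_mem_spot)
  obtain ⟨fd', pr', R'⟩ := R₉.focus (x := y + step d) List.mem_cons_self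
  exact ⟨_, f₉, fd', pr',
    .head t₁ (.head t₂ (t₃.trans (.head t₄ (t₅.trans (.single t₆))))), R'⟩

/-- The state of the game represents a configuration of the machine. -/
def Represents (c : TM0.Cfg Bool (Fin (n + 1))) (s : State) : Prop :=
  ∃ d J f x g fd pr, s = machineState (numModes n) J f (tapeSite x + spot true) none ∧
    (∀ z, g z = c.Tape.nth (z - x)) ∧
    Rep (numModes n) (code (c.q, d, Phase.run)) J f g x (cell x (g x) fd pr)

theorem nth_move_eq (T : Tape Bool) (d : Dir) (z : ℤ) : (T.move d).nth z = T.nth (z + step d) := by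
  cases d
  · exact Tape.move_left_nth T z
  · exact Tape.move_right_nth T z

theorem Represents.step {c c' : TM0.Cfg Bool (Fin (n + 1))} {s : State}
    (hc : TM0.step M c = some c') (h : Represents c s) :
    ∃ s', TransGen ((game r).Round (table M)) s s' ∧ Represents c' s' := by
  obtain ⟨d, J, f, x, g, fd, pr, rfl, hg, R⟩ := h
  obtain ⟨q, T⟩ := c
  simp only [TM0.step, Option.map_eq_some_iff] at hc
  obtain ⟨⟨q', a⟩, hM, rfl⟩ := hc
  have hhead : g x = T.head := by
    rw [hg, sub_self]
    rfl
  have hT : (table M).lookup ((game r).observe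
      (machineState (numModes n) J f (tapeSite x + spot true) none)) =
      some (act q d (g x) q' a) := by
    refine (lookup_table r M (e := true) R mem_cityTiles_of_mem_spot decide_mem_spot).trans ?_
    simp [command, hhead, hM]
  cases a with
  | move d' =>
    have h₁ := R.run_moveOrder (st := none) r (mkCity_capped le_rfl) d' x
    obtain ⟨f₂, h₂, R₂⟩ := R.run_counterOrder (w := tapeSite (x + CivVI.step d') + spot true)
      (st := none) r (mkCity_capped le_rfl) (code_le (q', d', Phase.run))
    obtain ⟨J', f', fd', pr', t, R'⟩ := exists_reflTransGen_arrive r M R₂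
    refine ⟨_, .head' ((h₁.append h₂).round hT) t, d', J', f', _, g, fd', pr', rfl, fun z => ?_, R'⟩
    dsimp only
    rw [hg, nth_move_eq]
    congr 1
    ring
  | write a =>
    let g' : ℤ → Bool := Function.update g x a
    have hgg : ∀ z ≠ x, g' z = g z := fun z hz => Function.update_of_ne hz ..
    have hgx : g' x = a := Function.update_self ..
    obtain ⟨f₁, h₁, R₁⟩ : ∃ f₁, (game r).Run (if g x = a then [] else [flipOrder (g x)])
        (machineState (numModes n) J f (tapeSite x + spot true) none)
        (machineState (numModes n) J f₁ (tapeSite x + spot true) none) ∧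
        Rep (numModes n) (code (q, d, Phase.run)) J f₁ g' x (cell x (g' x) fd pr) := by
      by_cases e : g x = a
      · rw [if_pos e]
        have : g' = g := by
          subst e
          exact Function.update_eq_self x g
        exact ⟨f, .nil _, this ▸ R⟩
      · rw [if_neg e]
        have := R.run_flipOrder (st := none) r hgg
        rwa [show (!g x) = g' x by rw [hgx]; cases a <;> simpa using e] at this
    obtain ⟨f₂, h₂, R₂⟩ := R₁.run_counterOrder (w := tapeSite x + spot true)
      (st := none) r (mkCity_capped le_rfl) (code_le (q', d, Phase.run))
    refine ⟨_, .single ((h₁.append h₂).round hT), d, J, f₂, x, g', fd, pr, rfl, fun z => ?_, R₂⟩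
    dsimp only
    rw [Tape.write_nth]
    by_cases e : z = x
    · rw [e, hgx, sub_self, if_pos rfl]
    · rw [hgg z e, hg, if_neg (sub_ne_zero.2 e)]

theorem Represents.halt {c : TM0.Cfg Bool (Fin (n + 1))} {s : State}
    (hc : TM0.step M c = none) (h : Represents c s) :
    (table M).lookup ((game r).observe s) = none := by
  obtain ⟨d, J, f, x, g, fd, pr, rfl, hg, R⟩ := h
  obtain ⟨q, T⟩ := c
  simp only [TM0.step, Option.map_eq_none_iff] at hc
  have hhead : g x = T.head := by
    rw [hg, sub_self]
    rfl
  refine (lookup_table r M (e := true) R mem_cityTiles_of_mem_spot decide_mem_spot).trans ?_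
  simp [command, hhead, hc]

end simulation

end CivVI


namespace CivVI

open Turing

/-- The City on a tile in the initial state, for the input `l` of the machine and the value `k`
of the counter. -/
def initialCity (k : ℕ) (l : List Bool) (p : Hex) : City :=
  mkCity p 2 [p + spot (if p.2 = 0 then l.getI ((p.1 / 4).toNat - 1) else decide (p.1 / 4 < k))]
    0 2 0

/-- The tiles of the tape with a City in the initial state. -/
def initialSites (l : List Bool) : List Hex :=
  (List.range (l.length + 1)).map fun i => tapeSite ((i + 1 : ℕ) : ℤ)

/-- The initial state for the input `l` of the machine, which begins at position `1`. -/
noncomputable def initialState (n : ℕ) (l : List Bool) : State :=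
  machineState (numModes n) (initialSites l)
    (initialCity (code ((0 : Fin (n + 1)), Dir.right, Phase.run)) l) (tapeSite 1 + spot true) none

theorem tapeSite_mem_initialSites {l : List Bool} {x : ℤ} :
    tapeSite x ∈ initialSites l ↔ 1 ≤ x ∧ x ≤ l.length + 1 := by
  simp only [initialSites, List.mem_map, List.mem_range, tapeSite_inj]
  constructor
  · rintro ⟨i, hi, rfl⟩
    omega
  · intro h
    exact ⟨(x - 1).toNat, by omega, by omega⟩

theorem initialCity_tapeSite (k : ℕ) (l : List Bool) (i : ℕ) :
    initialCity k l (tapeSite ((i + 1 : ℕ) : ℤ)) = cell ((i + 1 : ℕ) : ℤ) (l.getI i) 0 0 := by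
  have : ((tapeSite ((i + 1 : ℕ) : ℤ)).1 / 4).toNat - 1 = i := by
    simp only [tapeSite]
    omega
  rw [initialCity, this]
  rfl

theorem initialCity_counterSite (k : ℕ) (l : List Bool) (j : ℕ) :
    initialCity k l (counterSite j) =
      mkCity (counterSite j) 2 [counterSite j + spot (decide (j < k))] 0 2 0 := by
  have : ((counterSite j).1 / 4 < k) ↔ j < k := by
    simp only [counterSite]
    omega
  simp [initialCity, this, show (counterSite j).2 = 8 from rfl]

theorem mk₁_nth_eq_default {l : List Bool} {x : ℤ} (hx : x < 0 ∨ l.length ≤ x) :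
    (Tape.mk₁ l).nth x = false := by
  rcases hx with hx | hx
  · exact Tape.mk₁_nth_of_neg l hx
  · obtain ⟨i, rfl⟩ := Int.eq_ofNat_of_zero_le (a := x) (by omega)
    rw [Tape.mk₁_nth_natCast, List.getI_eq_default _ (by omega)]
    rfl

theorem rep_initialState (n : ℕ) (l : List Bool) :
    Rep (numModes n) (code ((0 : Fin (n + 1)), Dir.right, Phase.run)) (initialSites l)
      (initialCity (code ((0 : Fin (n + 1)), Dir.right, Phase.run)) l)
      (fun z => (Tape.mk₁ l).nth (z - 1)) 1 (cell 1 ((Tape.mk₁ l).nth (1 - 1)) 0 0) := by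
  have hcell : ∀ x : ℤ, tapeSite x ∈ initialSites l →
      initialCity (code ((0 : Fin (n + 1)), Dir.right, Phase.run)) l (tapeSite x) =
        cell x ((Tape.mk₁ l).nth (x - 1)) 0 0 := by
    intro x hx
    rw [tapeSite_mem_initialSites] at hx
    obtain ⟨i, rfl⟩ : ∃ i : ℕ, x = (i + 1 : ℕ) := ⟨(x - 1).toNat, by omega⟩
    rw [initialCity_tapeSite, show (((i + 1 : ℕ) : ℤ) - 1) = i by omega, Tape.mk₁_nth_natCast]
  have h₁ : tapeSite 1 ∈ initialSites l := tapeSite_mem_initialSites.2 (by omega)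
  exact
    { layout := fun p => ⟨rfl, rfl⟩
      sites := by
        intro p hp
        obtain ⟨i, -, rfl⟩ := List.mem_map.1 hp
        exact ⟨_, rfl⟩
      le := code_le _
      counter := fun j _ => initialCity_counterSite _ l j
      mem := h₁
      city := hcell 1 h₁
      cells := fun x _ hx => ⟨0, 0, hcell x hx⟩
      blank := fun x hx => mk₁_nth_eq_default (by
        rw [tapeSite_mem_initialSites] at hx
        omega) }

theorem represents_initialState (n : ℕ) (l : List Bool) :
    Represents (⟨0, Tape.mk₁ l⟩ : TM0.Cfg Bool (Fin (n + 1))) (initialState n l) :=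
  ⟨.right, _, _, 1, _, 0, 0, rfl, fun _ => rfl, rep_initialState n l⟩

theorem cityTiles_nodup (p : Hex) : (cityTiles p).Nodup := by
  obtain ⟨x, y⟩ := p
  simp [cityTiles, Hex.neighbors, HexDir.vec]

theorem dist_le_of_mem_cityTiles {h p : Hex} (hh : h ∈ cityTiles p) : Hex.dist h p ≤ 3 := by
  have := natAbs_le_of_mem_cityTiles hh
  unfold Hex.dist
  omega

theorem valid_mkCity (p : Hex) (b : Bool) (fd cap pr : ℕ) :
    (mkCity p 2 [p + spot b] fd cap pr).Valid where
  center_mem := self_mem_cityTiles p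
  tiles_nodup := cityTiles_nodup p
  tiles_dist _ hh := dist_le_of_mem_cityTiles hh
  worked_nodup := List.nodup_singleton _
  worked_tiles h hh := by
    rw [List.mem_singleton.1 hh]
    exact ⟨spot_mem_cityTiles p b, add_spot_ne p b⟩
  population_eq := rfl

theorem sites_nodup (n : ℕ) (l : List Bool) : (sites n (initialSites l)).Nodup := by
  refine List.Nodup.append (List.Nodup.map ?_ List.nodup_range)
    (List.Nodup.map (fun i j h => counterSite_inj.1 h) List.nodup_range) ?_
  · intro i j h
    have := tapeSite_inj.1 h
    omega
  · intro p h₁ h₂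
    obtain ⟨i, -, rfl⟩ := List.mem_map.1 h₁
    obtain ⟨j, -, e⟩ := List.mem_map.1 h₂
    exact counterSite_ne_tapeSite _ _ e

theorem valid_initialState (n : ℕ) (l : List Bool) : Valid (initialState n l) where
  cities_valid c hc := by
    obtain ⟨p, -, rfl⟩ := List.mem_map.1 hc
    exact valid_mkCity ..
  cities_pairwise := by
    refine List.pairwise_map.2 (List.Pairwise.imp_of_mem ?_ (sites_nodup (numModes n) l))
    intro p q hp hq hpq
    have hp := (rep_initialState n l).isSite p hp
    have hq := (rep_initialState n l).isSite q hq
    exact ⟨hp.four_le_dist hq hpq, fun h h₁ h₂ => hpq (hp.eq_of_mem hq h₁ h₂)⟩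
  disjoint := List.disjoint_nil_right _
  improved h hh := by
    obtain ⟨j, hj, rfl⟩ := List.mem_map.1 (hh.resolve_right List.not_mem_nil)
    refine ⟨?_, _, List.mem_map.2 ⟨counterSite j, List.mem_append_right _
      (List.mem_map.2 ⟨j, hj, rfl⟩), rfl⟩, spot_mem_cityTiles _ _, add_spot_ne _ _⟩
    simp [IsGrassland, counterSite, spot]

theorem primrec_int_mul_add (m : ℕ) :
    Primrec fun p : List Bool × ℕ => ((4 * p.2 + m : ℕ) : ℤ) :=
  Primrec.int_natCast.comp (Primrec.nat_add.comp
    (Primrec.nat_mul.comp (Primrec.const 4) Primrec.snd) (Primrec.const m))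

theorem primrec_cell :
    Primrec fun p : List Bool × ℕ => cell ((p.2 + 1 : ℕ) : ℤ) (p.1.getI p.2) 0 0 := by
  have h₁ (m : ℕ) (y : ℤ) : Primrec fun p : List Bool × ℕ => (((4 * p.2 + m : ℕ) : ℤ), y) :=
    (primrec_int_mul_add m).pair (.const y)
  have h₂ : Primrec fun p : List Bool × ℕ => City.equiv.symm ((((4 * p.2 + 4 : ℕ) : ℤ), (0 : ℤ)),
      [(((4 * p.2 + 4 : ℕ) : ℤ), (0 : ℤ)), (((4 * p.2 + 5 : ℕ) : ℤ), (0 : ℤ)),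
        (((4 * p.2 + 3 : ℕ) : ℤ), (0 : ℤ)), (((4 * p.2 + 5 : ℕ) : ℤ), (-1 : ℤ)),
        (((4 * p.2 + 4 : ℕ) : ℤ), (-1 : ℤ)), (((4 * p.2 + 4 : ℕ) : ℤ), (1 : ℤ)),
        (((4 * p.2 + 3 : ℕ) : ℤ), (1 : ℤ))], 2,
      [cond (p.1.getI p.2) (((4 * p.2 + 5 : ℕ) : ℤ), (-1 : ℤ))
        (((4 * p.2 + 4 : ℕ) : ℤ), (-1 : ℤ))], 0, some 2, 0) :=
    Primrec.of_equiv_symm.comp ((h₁ 4 0).pair (Primrec.pair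
      (Primrec.list_cons.comp (h₁ 4 0) (Primrec.list_cons.comp (h₁ 5 0)
        (Primrec.list_cons.comp (h₁ 3 0) (Primrec.list_cons.comp (h₁ 5 (-1))
        (Primrec.list_cons.comp (h₁ 4 (-1)) (Primrec.list_cons.comp (h₁ 4 1)
        (Primrec.list_cons.comp (h₁ 3 1) (.const []))))))))
      (Primrec.pair (.const 2) (Primrec.pair (Primrec.list_cons.comp
        (Primrec.cond (Primrec.list_getI.comp Primrec.fst Primrec.snd) (h₁ 5 (-1)) (h₁ 4 (-1)))
        (.const [])) (.const (0, some 2, 0))))))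
  refine h₂.of_eq fun p => ?_
  have e₃ : ((4 * p.2 + 3 : ℕ) : ℤ) = 4 * ((p.2 + 1 : ℕ) : ℤ) + -1 := by omega
  have e₄ : ((4 * p.2 + 4 : ℕ) : ℤ) = 4 * ((p.2 + 1 : ℕ) : ℤ) := by omega
  have e₅ : ((4 * p.2 + 5 : ℕ) : ℤ) = 4 * ((p.2 + 1 : ℕ) : ℤ) + 1 := by omega
  rw [e₃, e₄, e₅]
  cases p.1.getI p.2 <;> simp [City.equiv, cell, mkCity, cityTiles, Hex.neighbors, HexDir.vec,
    tapeSite, spot]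

theorem computable_initialState (n : ℕ) : Computable (initialState n) := by
  have h₁ : Primrec fun l : List Bool =>
      (List.range (l.length + 1)).map fun i => cell ((i + 1 : ℕ) : ℤ) (l.getI i) 0 0 :=
    Primrec.list_map (Primrec.list_range.comp (Primrec.succ.comp Primrec.list_length))
      primrec_cell.to₂
  have h₂ : Primrec fun l : List Bool => State.equiv.symm
      (((List.range (l.length + 1)).map fun i => cell ((i + 1 : ℕ) : ℤ) (l.getI i) 0 0) ++
        (List.range (numModes n)).map (fun j => mkCity (counterSite j) 2 [counterSite j + spot
          (decide (j < code ((0 : Fin (n + 1)), Dir.right, Phase.run)))] 0 2 0),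
        monasteries (numModes n), [], tapeSite 1 + spot true, none) :=
    Primrec.of_equiv_symm.comp ((Primrec.list_append.comp h₁ (.const _)).pair (.const _))
  refine h₂.to_comp.of_eq fun l => ?_
  simp only [initialState, machineState, layoutState, sites, initialSites, List.map_append,
    List.map_map]
  refine congrArg (fun c => State.equiv.symm (c, _)) ?_
  congr 1
  · exact List.map_congr_left fun i _ => (initialCity_tapeSite _ l i).symm
  · exact List.map_congr_left fun j _ => (initialCity_counterSite _ l j).symm

theorem simulatesUniversal (r : Rules) : ∃ T : CommandTable Obs Order,
    (game r).SimulatesUniversal T ∧ (game r).UndecidableUnder T :=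
  CivGame.exists_simulatesUniversal fun n M => ⟨table M, initialState n,
    computable_initialState n, fun l => ⟨valid_initialState n l,
      CivGame.halts_iff_of_simulation (TM0.step M) Represents (fun _ _ _ => Represents.step r M)
        (fun _ _ => Represents.halt r M) (represents_initialState n l)⟩⟩

end CivVI

theorem mainTheorem4 :
    (∀ r : CivBE.Rules, ∃ T : CommandTable (ℕ × CivBE.Improvement) CivBE.Order,
      (CivBE.game r).SimulatesUniversal T ∧ (CivBE.game r).UndecidableUnder T) ∧
    (∀ r : CivV.Rules, ∃ T : CommandTable (ℕ × CivV.Improvement) CivV.Order,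
      (CivV.game r).SimulatesUniversal T ∧ (CivV.game r).UndecidableUnder T) ∧
    (∀ r : CivVI.Rules, ∃ T : CommandTable CivVI.Obs CivVI.Order,
      (CivVI.game r).SimulatesUniversal T ∧ (CivVI.game r).UndecidableUnder T) :=
  ⟨CivBE.simulatesUniversal, CivV.simulatesUniversal, CivVI.simulatesUniversal⟩
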